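/- Throughout, $M$ and $\tilde M$ are smooth oriented $n$-dimensional Riemannian manifolds (Hausdorff, second countable, without boundary), with their Riemannian measures. For $1\le p<\infty$, $L^p(M,\Lambda^k)$ is the Banach space of the differential $k$-forms $\theta$ on $M$ with locally integrable coefficients and $\|\theta\|_p=\left(\int_M|\theta|^p\,dx\right)^{1/p}<\infty$ (forms that agree almost everywhere are identified). A form $\theta\in L^1_{loc}(M,\Lambda^{k})$ is the weak differential $d\phi$ of $\phi\in L^1_{loc}(M,\Lambda^{k-1})$ if $\int_M\theta\wedge\omega=(-1)^k\int_M\phi\wedge d\omega$ for every smooth compactly supported $(n-k)$-form $\omega$. Let $Z^k_p(M)$ be the space of weakly closed forms in $L^p(M,\Lambda^k)$, let $B^k_{q,p}(M)=d\left(L^q(M,\Lambda^{k-1})\right)\cap L^p(M,\Lambda^k)$, and put $$H^k_{q,p}(M)=Z^k_p(M)/B^k_{q,p}(M),\qquad \overline H^k_{q,p}(M)=Z^k_p(M)/\overline{B^k_{q,p}(M)},$$ the closure being taken in $L^p(M,\Lambda^k)$ and the second space carrying the quotient norm. Let $\Omega^{k-1}_{q,p}(M)$ be the space of the $\phi\in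 L^q(M,\Lambda^{k-1})$ whose weak differential exists and lies in $L^p(M,\Lambda^{k})$, with the norm $\max(\|\phi\|_q,\|d\phi\|_p)$. For a diffeomorphism $f:M\to\tilde M$ let $\sigma_k(f,x)$ be the $k$-th elementary symmetric polynomial in the singular values of $df_x$ (with $\sigma_0=1$), and $J_f=\sigma_n(f)$. For $1\le s<\infty$ and $0<t\le\infty$ one writes $f\in \mathrm{BD}^k_{(s,t)}(M,\tilde M)$ if $(\sigma_k(f))^sJ_f^{-1}\in L^t(M)$. A fraction below whose denominator is $0$ and whose numerator is positive means $\infty$. **Theorem.** Let $0\le k\le n$, let $1\le p\le\tilde p<\infty$, and let $f:M\to\tilde M$ be a smooth diffeomorphism (not necessarily orientation preserving) with $f\in \mathrm{BD}^k_{(\tilde p,t)}(M,\tilde M)$, where $t=\frac{p}{\tilde p-p}$. Then the following holds. (A) $f^*:L^{\tilde p}(\tilde M,\Lambda^k)\to L^p(M,\Lambda^k)$ is a well defined bounded operator, and $f^*(Z^k_{\tilde p}(\tilde M))\subset Z^k_p(M)$. (B) Suppose that $k\ge1$, $1<\tilde q\le q<\infty$ and $f\in \mathrm{BD}^{n-k+1}_{(\tilde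 q',r)}(M,\tilde M)$ with $\tilde q'=\frac{\tilde q}{\tilde q-1}$ and $r=\frac{q(\tilde q-1)}{q-\tilde q}$. Then for every $\omega\in Z^k_{\tilde p}(\tilde M)$, $[f^*\omega]=0$ in $H^k_{q,p}(M)$ implies $[\omega]=0$ in $H^k_{\tilde q,\tilde p}(\tilde M)$. Thus $H^k_{q,p}(M)=0$ implies $H^k_{\tilde q,\tilde p}(\tilde M)=0$. (C) Suppose that $k\ge1$, $1\le q\le\tilde q<\infty$ and $f\in \mathrm{BD}^{k-1}_{(\tilde q,u)}(M,\tilde M)$ with $u=\frac{q}{\tilde q-q}$. Then (a) $f^*:\Omega^{k-1}_{\tilde q,\tilde p}(\tilde M)\to\Omega^{k-1}_{q,p}(M)$ is a well defined bounded operator; (b) $f^*:H^k_{\tilde q,\tilde p}(\tilde M)\to H^k_{q,p}(M)$, $[\omega]\mapsto[f^*\omega]$, is a well defined linear map; (c) $f^*:\overline H^k_{\tilde q,\tilde p}(\tilde M)\to\overline H^k_{q,p}(M)$, $[\omega]\mapsto[f^*\omega]$, is a well defined bounded operator. -/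

import Mathlib

open MeasureTheory Manifold Bundle
open scoped ContDiff ENNReal

namespace LqpCohomology

noncomputable section

/-- The model space `ℝⁿ` of the manifolds (with its Euclidean norm). -/
abbrev Model (n : ℕ) : Type := EuclideanSpace ℝ (Fin n)

/-- Coordinate systems on open subsets of `M`; the admissible ones are those in the maximal atlas. -/
abbrev Chart (n : ℕ) (M : Type*) [TopologicalSpace M] : Type _ :=
  OpenPartialHomeomorph M (Model n)

section Forms

variable {n : ℕ} {M : Type*} [TopologicalSpace M] [ChartedSpace (Model n) M]

/-- Differential forms of degree `k` on the `n`-manifold `M`, without any regularity. -/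
abbrev DForm (n : ℕ) (M : Type*) [TopologicalSpace M] [ChartedSpace (Model n) M] (k : ℕ) :
    Type _ :=
  ∀ x : M, TangentSpace (𝓡 n) x [⋀^Fin k]→L[ℝ] ℝ

/-- The differential of the inverse of a chart `e` at the point `y` of its target; it sends the
`i`-th basis vector of `ℝⁿ` to the coordinate vector field `∂ᵢ`. -/
def frameMap (e : Chart n M) (y : Model n) :
    Model n →L[ℝ] TangentSpace (𝓡 n) (e.symm y) :=
  mfderiv (𝓡 n) (𝓡 n) e.symm y

/-- The expression of a form in the chart `e`, that is, its pullback under `e⁻¹`. It is meaningful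
on the target of `e`. -/
def inChart {k : ℕ} (e : Chart n M) (θ : DForm n M k) (y : Model n) :
    Model n [⋀^Fin k]→L[ℝ] ℝ :=
  (θ (e.symm y)).compContinuousLinearMap (frameMap e y)

/-- Smooth forms: the coefficients in every coordinate system are `C^∞`. -/
def IsSmoothForm {k : ℕ} (η : DForm n M k) : Prop :=
  ∀ e ∈ IsManifold.maximalAtlas (𝓡 n) ∞ M, ContDiffOn ℝ ∞ (inChart e η) e.target

/-- Smooth forms with compact support. -/
def IsTestForm {k : ℕ} (η : DForm n M k) : Prop :=
  IsSmoothForm η ∧ IsCompact (closure {x | η x ≠ 0})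

/-- The coefficient `θ(∂_{i₁}, …, ∂_{i_k})` of a form in the chart `e`, as a function on the target
of `e`. -/
def coeff {k : ℕ} (e : Chart n M) (θ : DForm n M k) (i : Fin k → Fin n) (y : Model n) : ℝ :=
  θ (e.symm y) fun a => frameMap e y (EuclideanSpace.single (i a) 1)

/-- `L^1_loc` forms: the coefficients in every coordinate system are (measurable and) locally
integrable. -/
def IsLocIntegrable {k : ℕ} (θ : DForm n M k) : Prop :=
  ∀ e ∈ IsManifold.maximalAtlas (𝓡 n) ∞ M, ∀ i : Fin k → Fin n,
    LocallyIntegrableOn (coeff e θ i) e.target volume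

theorem IsLocIntegrable.add {k : ℕ} {θ θ' : DForm n M k} (h : IsLocIntegrable θ)
    (h' : IsLocIntegrable θ') : IsLocIntegrable (θ + θ') :=
  fun e he i => (h e he i).add (h' e he i)

theorem IsLocIntegrable.smul {k : ℕ} {θ : DForm n M k} (c : ℝ) (h : IsLocIntegrable θ) :
    IsLocIntegrable (c • θ) :=
  fun e he i => (h e he i).smul c

theorem IsLocIntegrable.zero {k : ℕ} : IsLocIntegrable (0 : DForm n M k) :=
  fun _ _ _ => locallyIntegrableOn_zero

/-- The exterior differential of a smooth form, computed at each point in the preferred chart. -/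
def extD {k : ℕ} (η : DForm n M k) : DForm n M (k + 1) := fun x =>
  (extDeriv (inChart (chartAt (Model n) x) η) (chartAt (Model n) x x)).compContinuousLinearMap
    (mfderiv (𝓡 n) (𝓡 n) (chartAt (Model n) x) x : TangentSpace (𝓡 n) x →L[ℝ] Model n)

/-- The exterior product of two forms (the sum over shuffles of signed products). -/
def wedge {k l : ℕ} (θ : DForm n M k) (η : DForm n M l) (x : M) :
    TangentSpace (𝓡 n) x [⋀^Fin (k + l)]→ₗ[ℝ] ℝ :=
  ((LinearMap.mul' ℝ ℝ).compAlternatingMap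
    ((θ x).toAlternatingMap.domCoprod (η x).toAlternatingMap)).domDomCongr finSumFinEquiv

theorem wedge_add_left {k l : ℕ} (θ θ' : DForm n M k) (η : DForm n M l) (x : M) :
    wedge (θ + θ') η x = wedge θ η x + wedge θ' η x := by
  have h := congrArg (fun z => ((LinearMap.mul' ℝ ℝ).compAlternatingMap z).domDomCongr
    finSumFinEquiv) ((AlternatingMap.domCoprod' (R' := ℝ)).map_add
      ((θ x).toAlternatingMap ⊗ₜ[ℝ] (η x).toAlternatingMap)
      ((θ' x).toAlternatingMap ⊗ₜ[ℝ] (η x).toAlternatingMap))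
  simp only [← TensorProduct.add_tmul, AlternatingMap.domCoprod'_apply] at h
  refine h.trans ?_
  ext v
  simp [wedge]

theorem wedge_smul_left {k l : ℕ} (c : ℝ) (θ : DForm n M k) (η : DForm n M l) (x : M) :
    wedge (c • θ) η x = c • wedge θ η x := by
  have h := congrArg (fun z => ((LinearMap.mul' ℝ ℝ).compAlternatingMap z).domDomCongr
    finSumFinEquiv) ((AlternatingMap.domCoprod' (R' := ℝ)).map_smul c
      ((θ x).toAlternatingMap ⊗ₜ[ℝ] (η x).toAlternatingMap))
  simp only [TensorProduct.smul_tmul', AlternatingMap.domCoprod'_apply] at h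
  refine h.trans ?_
  ext v
  simp [wedge]

/-- The pullback `f^* θ` of a form. -/
def pullback {N : Type*} [TopologicalSpace N] [ChartedSpace (Model n) N] {k : ℕ}
    (f : M ≃ₘ^∞⟮𝓡 n, 𝓡 n⟯ N) (θ : DForm n N k) : DForm n M k := fun x =>
  (θ (f x)).compContinuousLinearMap (mfderiv (𝓡 n) (𝓡 n) f x)

end Forms

/-- An orientation of the manifold `M`, given by an oriented atlas: a set of admissible charts that
cover `M` and whose coordinate changes have positive Jacobian determinants. -/
structure OrientedAtlas (n : ℕ) (M : Type*) [TopologicalSpace M] [ChartedSpace (Model n) M] where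
  /-- The positive charts. -/
  charts : Set (Chart n M)
  subset_maximalAtlas : charts ⊆ IsManifold.maximalAtlas (𝓡 n) ∞ M
  exists_mem_source : ∀ x : M, ∃ e ∈ charts, x ∈ e.source
  det_pos : ∀ e ∈ charts, ∀ e' ∈ charts, ∀ y ∈ (e.symm.trans e').source,
    0 < (fderiv ℝ (e' ∘ e.symm) y).det

namespace OrientedAtlas

variable {n : ℕ} {M : Type*} [TopologicalSpace M] [ChartedSpace (Model n) M]

/-- A positive chart around `x`. -/
def chart (o : OrientedAtlas n M) (x : M) : Chart n M := (o.exists_mem_source x).choose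

end OrientedAtlas

section Riemannian

variable {n : ℕ} {M : Type*} [TopologicalSpace M] [ChartedSpace (Model n) M]

instance instFiniteDimensionalTangent (x : M) : FiniteDimensional ℝ (TangentSpace (𝓡 n) x) :=
  inferInstanceAs (FiniteDimensional ℝ (Model n))

theorem finrank_tangent (x : M) : Module.finrank ℝ (TangentSpace (𝓡 n) x) = n :=
  (finrank_euclideanSpace_fin : Module.finrank ℝ (Model n) = n)

theorem exists_countable_charts (n : ℕ) (M : Type*) [TopologicalSpace M]
    [ChartedSpace (Model n) M] [SecondCountableTopology M] :
    ∃ s : Set M, s.Countable ∧ ⋃ x ∈ s, (chartAt (Model n) x).source = Set.univ :=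
  TopologicalSpace.countable_cover_nhds fun x => chart_source_mem_nhds (Model n) x

/-- Countably many points such that the preferred charts at these points cover `M`. -/
def centers (n : ℕ) (M : Type*) [TopologicalSpace M] [ChartedSpace (Model n) M]
    [SecondCountableTopology M] : Set M :=
  (exists_countable_charts n M).choose

instance instCountableCenters [SecondCountableTopology M] : Countable (centers n M) :=
  (exists_countable_charts n M).choose_spec.1.to_subtype

instance instEncodableCenters [SecondCountableTopology M] : Encodable (centers n M) :=
  Encodable.ofCountable _

/-- The domains of the charts at the chosen countably many points, made disjoint: from each domain
one removes the previous ones. These sets form a countable Borel partition of `M`. -/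
def piece [SecondCountableTopology M] (c : centers n M) : Set M :=
  (chartAt (Model n) (c : M)).source \
    ⋃ (c' : centers n M) (_ : Encodable.encode c' < Encodable.encode c),
      (chartAt (Model n) (c' : M)).source

variable [RiemannianBundle (fun x : M => TangentSpace (𝓡 n) x)]

/-- An orthonormal basis of the tangent space at `x`. -/
def tangentONB (x : M) : OrthonormalBasis (Fin n) ℝ (TangentSpace (𝓡 n) x) :=
  (stdOrthonormalBasis ℝ (TangentSpace (𝓡 n) x)).reindex (finCongr (finrank_tangent x))

/-- The norm of a `k`-covector for the canonical scalar product of the exterior power: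
`|α|² = ∑_{i₁ < ⋯ < i_k} α(b_{i₁}, …, b_{i_k})²` for an orthonormal basis `b`. The sum is written
here over all multi-indices and divided by `k!`, which is the same as `α` is alternating. -/
def formNorm {k : ℕ} {x : M} (α : TangentSpace (𝓡 n) x [⋀^Fin k]→L[ℝ] ℝ) : ℝ :=
  √((∑ i : Fin k → Fin n, (α fun a => tangentONB x (i a)) ^ 2) / (k.factorial : ℝ))

/-- The matrix `(g_{ij})` of the metric in the chart `e`. -/
def gram (e : Chart n M) (y : Model n) : Matrix (Fin n) (Fin n) ℝ :=
  Matrix.gram ℝ fun i => frameMap e y (EuclideanSpace.single i 1)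

/-- The Riemannian volume of the domain of the chart `e`, `√det(g_{ij}) dy₁ ⋯ dyₙ`, as a measure
on `M` that is carried by this domain. -/
def chartVolume [MeasurableSpace M] (e : Chart n M) : Measure M :=
  ((volume.restrict e.target).withDensity fun y => ENNReal.ofReal √(gram e y).det).map e.symm

/-- The Riemannian volume measure of `M`: on each set of a countable Borel partition into subsets of
chart domains it is `√det(g_{ij}) dy₁ ⋯ dyₙ`. -/
def riemVolume (n : ℕ) (M : Type*) [TopologicalSpace M] [ChartedSpace (Model n) M]
    [SecondCountableTopology M] [MeasurableSpace M]
    [RiemannianBundle (fun x : M => TangentSpace (𝓡 n) x)] : Measure M :=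
  Measure.sum fun c : centers n M =>
    (chartVolume (chartAt (Model n) (c : M))).restrict (piece c)

/-- The function `h` such that a form `η` of top degree is `h` times the oriented Riemannian volume
form: the value of `η` at a positively oriented orthonormal basis. -/
def topDensity (o : OrientedAtlas n M) {m : ℕ} (h : m = n)
    (η : ∀ x : M, TangentSpace (𝓡 n) x [⋀^Fin m]→ₗ[ℝ] ℝ) (x : M) : ℝ :=
  (SignType.sign (Matrix.det (Matrix.of fun i j : Fin n =>
      (show Model n from mfderiv (𝓡 n) (𝓡 n) (o.chart x) x (tangentONB x j)) i)) : ℝ) *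
    η x fun a => tangentONB x (Fin.cast h a)

theorem topDensity_add (o : OrientedAtlas n M) {k l : ℕ} (h : k + l = n) (θ θ' : DForm n M k)
    (η : DForm n M l) :
    topDensity o h (wedge (θ + θ') η) =
      topDensity o h (wedge θ η) + topDensity o h (wedge θ' η) := by
  ext x
  simp only [topDensity, wedge_add_left, Pi.add_apply, AlternatingMap.add_apply, mul_add]

theorem topDensity_smul (o : OrientedAtlas n M) {k l : ℕ} (h : k + l = n) (c : ℝ)
    (θ : DForm n M k) (η : DForm n M l) :
    topDensity o h (wedge (c • θ) η) = c • topDensity o h (wedge θ η) := by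
  ext x
  simp only [topDensity, wedge_smul_left, Pi.smul_apply, AlternatingMap.smul_apply, smul_eq_mul]
  ring

variable [SecondCountableTopology M] [MeasurableSpace M]

/-- Integrability of a form of top degree. -/
def TopIntegrable (o : OrientedAtlas n M) {m : ℕ} (h : m = n)
    (η : ∀ x : M, TangentSpace (𝓡 n) x [⋀^Fin m]→ₗ[ℝ] ℝ) : Prop :=
  Integrable (topDensity o h η) (riemVolume n M)

/-- The integral over the oriented manifold `M` of a form of top degree. -/
def topIntegral (o : OrientedAtlas n M) {m : ℕ} (h : m = n)
    (η : ∀ x : M, TangentSpace (𝓡 n) x [⋀^Fin m]→ₗ[ℝ] ℝ) : ℝ :=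
  ∫ x, topDensity o h η x ∂(riemVolume n M)

/-- `θ` is the weak exterior differential of the form `β` of degree `j`:
`∫ θ ∧ η = (-1)^(j+1) ∫ β ∧ dη` for all smooth compactly supported `η` of degree `n - (j+1)`.
That the two integrals exist, which is part of the definition here, is automatic for locally
integrable `β` and `θ`. -/
def IsWeakDeriv (o : OrientedAtlas n M) {j : ℕ} (β : DForm n M j) (θ : DForm n M (j + 1)) : Prop :=
  ∀ (l : ℕ) (h : j + 1 + l = n) (η : DForm n M l), IsTestForm η →
    TopIntegrable o h (wedge θ η) ∧
    TopIntegrable o (show j + (l + 1) = n by omega) (wedge β (extD η)) ∧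
    topIntegral o h (wedge θ η) =
      (-1) ^ (j + 1) * topIntegral o (show j + (l + 1) = n by omega) (wedge β (extD η))

theorem IsWeakDeriv.add {o : OrientedAtlas n M} {j : ℕ} {β β' : DForm n M j}
    {θ θ' : DForm n M (j + 1)} (h : IsWeakDeriv o β θ) (h' : IsWeakDeriv o β' θ') :
    IsWeakDeriv o (β + β') (θ + θ') := by
  intro l hl η hη
  obtain ⟨h1, h2, h3⟩ := h l hl η hη
  obtain ⟨h1', h2', h3'⟩ := h' l hl η hη
  simp only [TopIntegrable, topIntegral, topDensity_add] at *
  refine ⟨h1.add h1', h2.add h2', ?_⟩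
  simp only [Pi.add_apply]
  rw [integral_add h1 h1', integral_add h2 h2', h3, h3']
  ring

theorem IsWeakDeriv.smul {o : OrientedAtlas n M} {j : ℕ} {β : DForm n M j}
    {θ : DForm n M (j + 1)} (c : ℝ) (h : IsWeakDeriv o β θ) :
    IsWeakDeriv o (c • β) (c • θ) := by
  intro l hl η hη
  obtain ⟨h1, h2, h3⟩ := h l hl η hη
  simp only [TopIntegrable, topIntegral, topDensity_smul] at *
  refine ⟨h1.smul c, h2.smul c, ?_⟩
  simp only [Pi.smul_apply]
  rw [integral_smul, integral_smul, h3, smul_eq_mul, smul_eq_mul]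
  ring

theorem IsWeakDeriv.zero (o : OrientedAtlas n M) {j : ℕ} :
    IsWeakDeriv o (0 : DForm n M j) (0 : DForm n M (j + 1)) := by
  have h0 : ∀ {k l : ℕ} (h : k + l = n) (η : DForm n M l),
      topDensity o h (wedge (0 : DForm n M k) η) = 0 := by
    intro k l h η
    have := topDensity_smul o h 0 (0 : DForm n M k) η
    rwa [zero_smul, zero_smul] at this
  intro l hl η _
  simp only [TopIntegrable, topIntegral, h0]
  exact ⟨integrable_zero _ _ _, integrable_zero _ _ _, by simp⟩

end Riemannian

section Measurability

/-! The norm of a locally integrable form is measurable; this is needed for the triangle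
inequality in `L^p`. -/

theorem sum_sq_eq {n : ℕ} {V : Type*} [NormedAddCommGroup V] [InnerProductSpace ℝ V] {k : ℕ}
    (b : OrthonormalBasis (Fin n) ℝ V) (v : Fin n → V) (hv : LinearIndependent ℝ v)
    (α : V [⋀^Fin k]→L[ℝ] ℝ) :
    ∑ i : Fin k → Fin n, (α fun a => b (i a)) ^ 2 =
      ∑ J : Fin k → Fin n, ∑ J' : Fin k → Fin n, (∏ a, (Matrix.gram ℝ v)⁻¹ (J a) (J' a)) *
        ((α fun a => v (J a)) * (α fun a => v (J' a))) := by
  classical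
  have hdet : (Matrix.gram ℝ v).det ≠ 0 := (Matrix.posDef_gram_of_linearIndependent hv).det_pos.ne'
  set P : Matrix (Fin n) (Fin n) ℝ := Matrix.of fun i j => inner ℝ (b i) (v j) with hP
  have hG : Matrix.gram ℝ v = P.transpose * P := by
    ext i j
    rw [Matrix.gram_apply, Matrix.mul_apply, ← b.sum_inner_mul_inner]
    simp [hP, real_inner_comm]
  have hPd : IsUnit P.det := by
    rw [isUnit_iff_ne_zero]
    intro h
    exact hdet (by rw [hG, Matrix.det_mul, h, mul_zero])
  set Q := P⁻¹ with hQ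
  have hGi : (Matrix.gram ℝ v)⁻¹ = Q * Q.transpose := by
    rw [hG, Matrix.mul_inv_rev, Matrix.transpose_nonsing_inv]
  have hb : ∀ i, b i = ∑ j, Q j i • v j := by
    intro i
    have hvj : ∀ j, v j = ∑ l, P l j • b l := fun j => (b.sum_repr' (v j)).symm
    have h1 : P * Q = 1 := Matrix.mul_nonsing_inv _ hPd
    calc b i = ∑ l, (1 : Matrix (Fin n) (Fin n) ℝ) l i • b l := by simp [Matrix.one_apply]
      _ = ∑ l, (∑ j, P l j * Q j i) • b l := by rw [← h1]; rfl
      _ = ∑ j, Q j i • v j := by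
        simp_rw [hvj, Finset.smul_sum, Finset.sum_smul, smul_smul]
        rw [Finset.sum_comm]
        simp_rw [mul_comm]
  have hα : ∀ I : Fin k → Fin n, (α fun a => b (I a)) =
      ∑ J : Fin k → Fin n, (∏ a, Q (J a) (I a)) * α fun a => v (J a) := by
    intro I
    simp_rw [hb]
    have := α.toMultilinearMap.map_sum (fun a (j : Fin n) => Q j (I a) • v j)
    refine this.trans (Finset.sum_congr rfl fun J _ => ?_)
    have := α.toMultilinearMap.map_smul_univ (fun a => Q (J a) (I a)) (fun a => v (J a))
    simpa using this
  have hE : ∀ J J' : Fin k → Fin n, ∏ a, (Matrix.gram ℝ v)⁻¹ (J a) (J' a) =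
      ∑ I : Fin k → Fin n, (∏ a, Q (J a) (I a)) * (∏ a, Q (J' a) (I a)) := by
    intro J J'
    simp_rw [hGi, Matrix.mul_apply, Matrix.transpose_apply, ← Finset.prod_mul_distrib]
    rw [Finset.prod_univ_sum]
    simp
  simp_rw [hα, sq, Finset.sum_mul_sum, hE, Finset.sum_mul]
  rw [Finset.sum_comm]
  refine Finset.sum_congr rfl fun J _ => ?_
  rw [Finset.sum_comm]
  refine Finset.sum_congr rfl fun J' _ => Finset.sum_congr rfl fun I _ => ?_
  ring

theorem aemeasurable_map_symm {X Y : Type*} [TopologicalSpace X] [TopologicalSpace Y]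
    [MeasurableSpace X] [BorelSpace X] [MeasurableSpace Y] [BorelSpace Y]
    (e : OpenPartialHomeomorph X Y) {ν : Measure Y} {ρ : Y → ℝ≥0∞} {h : X → ℝ}
    (hh : AEMeasurable (fun y => h (e.symm y)) (ν.restrict e.target)) :
    AEMeasurable h (((ν.restrict e.target).withDensity ρ).map e.symm) := by
  classical
  set μ := (ν.restrict e.target).withDensity ρ
  have hac : μ ≪ ν.restrict e.target := withDensity_absolutelyContinuous _ _
  have he : AEMeasurable e.symm μ :=
    (e.continuousOn_symm.aemeasurable e.open_target.measurableSet).mono_ac hac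
  obtain ⟨g, hg, hhg⟩ := hh.mono_ac hac
  have hmem : ∀ᵐ y ∂μ, y ∈ e.target := hac.ae_le (ae_restrict_mem e.open_target.measurableSet)
  have hm : ∀ (g : Y → ℝ) (c : ℝ), Measurable g →
      Measurable (e.source.piecewise (fun x => g (e x)) fun _ => c) := by
    intro g c hg
    have h1 : Measurable (e.source.domRestrict (fun x => g (e x))) :=
      hg.comp (continuousOn_iff_continuous_domRestrict.1 e.continuousOn).measurable
    refine measurable_of_restrict_of_restrict_compl e.open_source.measurableSet ?_ ?_
    · rwa [Set.domRestrict_piecewise]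
    · rw [Set.domRestrict_piecewise_compl]
      exact measurable_const
  refine ⟨_, hm g 0 hg, ?_⟩
  have hhg' : ∀ᵐ y ∂μ, h (e.symm y) = g y ∧ y ∈ e.target := hhg.and hmem
  obtain ⟨S, hS, hSm, hS0⟩ := exists_measurable_superset_of_null (ae_iff.1 hhg')
  set T := e.source.piecewise (fun x => (S.indicator 1 : Y → ℝ) (e x)) (fun _ => 1) ⁻¹' {0}ᶜ
    with hT
  have hTm : MeasurableSet T :=
    hm _ 1 (measurable_one.indicator hSm) (measurableSet_singleton 0).compl
  have hT0 : μ.map e.symm T = 0 := by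
    rw [Measure.map_apply_of_aemeasurable he hTm]
    refine measure_mono_null (fun y hy => ?_) hS0
    by_contra hyS
    have h1 : h (e.symm y) = g y ∧ y ∈ e.target := by
      by_contra hc
      exact hyS (hS hc)
    have h2 : e.symm y ∈ e.source := e.map_target h1.2
    apply hy
    simp [h2, e.right_inv h1.2, hyS]
  refine ae_iff.2 (measure_mono_null (fun x hx => ?_) hT0)
  by_cases hxs : x ∈ e.source
  · have : e x ∈ S := by
      apply hS
      intro hc
      apply hx
      simp only [hxs, Set.piecewise_eq_of_mem]
      rw [← hc.1, e.left_inv hxs]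
    simp [hT, hxs, this]
  · simp [hT, hxs]

variable {n : ℕ} {M : Type*} [TopologicalSpace M] [ChartedSpace (Model n) M]

theorem continuousOn_frameMap (e : Chart n M) [IsManifold (𝓡 n) ∞ M]
    (he : e ∈ IsManifold.maximalAtlas (𝓡 n) ∞ M) (v : Model n) :
    ContinuousOn (fun y => (⟨e.symm y, frameMap e y v⟩ : TangentBundle (𝓡 n) M)) e.target := by
  have h1 := (contMDiffOn_symm_of_mem_maximalAtlas he).continuousOn_tangentMapWithin
    (by norm_num) e.open_target.uniqueMDiffOn
  have h2 : Continuous fun y : Model n => (⟨y, v⟩ : TangentBundle (𝓡 n) (Model n)) :=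
    (tangentBundleModelSpaceHomeomorph (𝓡 n)).symm.continuous.comp
      (continuous_id.prodMk continuous_const)
  refine (h1.comp h2.continuousOn fun y hy => hy).congr fun y hy => ?_
  simp only [Function.comp_apply, tangentMapWithin, frameMap]
  rw [mfderivWithin_of_isOpen e.open_target hy]
  rfl

theorem linearIndependent_frameMap [IsManifold (𝓡 n) ∞ M]
    (e : Chart n M) (he : e ∈ IsManifold.maximalAtlas (𝓡 n) ∞ M) {y : Model n}
    (hy : y ∈ e.target) :
    LinearIndependent ℝ fun i : Fin n => frameMap e y (EuclideanSpace.single i 1) := by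
  have hd : e.MDifferentiable (𝓡 n) (𝓡 n) :=
    ⟨(contMDiffOn_of_mem_maximalAtlas he).mdifferentiableOn (by norm_num),
      (contMDiffOn_symm_of_mem_maximalAtlas he).mdifferentiableOn (by norm_num)⟩
  have hinj : Function.Injective (frameMap e y) := (hd.symm.mfderiv_bijective hy).injective
  have hb := (EuclideanSpace.basisFun (Fin n) ℝ).toBasis.linearIndependent.map'
    (frameMap e y).toLinearMap (LinearMap.ker_eq_bot.2 hinj)
  have h : (fun i : Fin n => frameMap e y (EuclideanSpace.single i 1)) =
      (frameMap e y).toLinearMap ∘ (EuclideanSpace.basisFun (Fin n) ℝ).toBasis := by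
    ext i
    simp
  rw [h]
  exact hb

variable [RiemannianBundle (fun x : M => TangentSpace (𝓡 n) x)]

theorem formNorm_eq_norm {k : ℕ} {x : M} (α : TangentSpace (𝓡 n) x [⋀^Fin k]→L[ℝ] ℝ) :
    formNorm α = ‖(WithLp.toLp 2 fun i : Fin k → Fin n => α fun a => tangentONB x (i a) :
      EuclideanSpace ℝ (Fin k → Fin n))‖ / √(k.factorial : ℝ) := by
  rw [formNorm, Real.sqrt_div' _ (by positivity), EuclideanSpace.norm_eq]
  simp

theorem formNorm_nonneg {k : ℕ} {x : M} (α : TangentSpace (𝓡 n) x [⋀^Fin k]→L[ℝ] ℝ) :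
    0 ≤ formNorm α := Real.sqrt_nonneg _

theorem formNorm_add_le {k : ℕ} {x : M} (α β : TangentSpace (𝓡 n) x [⋀^Fin k]→L[ℝ] ℝ) :
    formNorm (α + β) ≤ formNorm α + formNorm β := by
  simp only [formNorm_eq_norm, ← add_div]
  gcongr
  exact norm_add_le (WithLp.toLp 2 fun i : Fin k → Fin n => α fun a => tangentONB x (i a))
    (WithLp.toLp 2 fun i : Fin k → Fin n => β fun a => tangentONB x (i a))

theorem formNorm_smul {k : ℕ} {x : M} (c : ℝ) (α : TangentSpace (𝓡 n) x [⋀^Fin k]→L[ℝ] ℝ) :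
    formNorm (c • α) = |c| * formNorm α := by
  simp only [formNorm_eq_norm, ← mul_div_assoc, ← Real.norm_eq_abs]
  congr 1
  exact norm_smul c (WithLp.toLp 2 fun i : Fin k → Fin n => α fun a => tangentONB x (i a))

theorem formNorm_zero {k : ℕ} {x : M} :
    formNorm (0 : TangentSpace (𝓡 n) x [⋀^Fin k]→L[ℝ] ℝ) = 0 := by
  simp [formNorm]

theorem continuousOn_gram [IsManifold (𝓡 n) ∞ M]
    [h : IsContMDiffRiemannianBundle (𝓡 n) ∞ (Model n) (fun x : M => TangentSpace (𝓡 n) x)]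
    (e : Chart n M) (he : e ∈ IsManifold.maximalAtlas (𝓡 n) ∞ M) :
    ContinuousOn (gram e) e.target := by
  have : IsContinuousRiemannianBundle (Model n) (fun x : M => TangentSpace (𝓡 n) x) := by
    obtain ⟨g, hg, hg'⟩ := h.exists_contMDiff
    exact ⟨g, hg.continuous, hg'⟩
  refine continuousOn_pi.2 fun i => continuousOn_pi.2 fun j => ?_
  exact (continuousOn_frameMap e he _).inner_bundle (continuousOn_frameMap e he _)

theorem aemeasurable_formNorm [SecondCountableTopology M] [MeasurableSpace M] [BorelSpace M]
    [IsManifold (𝓡 n) ∞ M]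
    [IsContMDiffRiemannianBundle (𝓡 n) ∞ (Model n) (fun x : M => TangentSpace (𝓡 n) x)]
    {k : ℕ} {θ : DForm n M k} (hθ : IsLocIntegrable θ) :
    AEMeasurable (fun x => formNorm (θ x)) (riemVolume n M) := by
  rw [riemVolume, aemeasurable_sum_measure_iff]
  intro c
  set e := chartAt (Model n) (c : M) with hec
  have he : e ∈ IsManifold.maximalAtlas (𝓡 n) ∞ M := IsManifold.chart_mem_maximalAtlas (c : M)
  refine AEMeasurable.restrict (aemeasurable_map_symm e ?_)
  have hcoef : ∀ i : Fin k → Fin n, AEMeasurable (coeff e θ i) (volume.restrict e.target) :=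
    fun i => (hθ e he i).aestronglyMeasurable.aemeasurable
  have hdet : ContinuousOn (fun y => (gram e y).det) e.target :=
    Continuous.comp_continuousOn (continuous_id.matrix_det) (continuousOn_gram e he)
  have hadj : ∀ i j, ContinuousOn (fun y => (gram e y).adjugate i j) e.target := fun i j =>
    Continuous.comp_continuousOn (g := fun G : Matrix (Fin n) (Fin n) ℝ => G.adjugate i j)
      (continuous_id.matrix_adjugate.matrix_elem i j) (continuousOn_gram e he)
  have hinv : ∀ i j, AEMeasurable (fun y => (gram e y)⁻¹ i j) (volume.restrict e.target) := by
    intro i j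
    simp only [Matrix.inv_def, Ring.inverse_eq_inv', Matrix.smul_apply, smul_eq_mul]
    exact (hdet.aemeasurable e.open_target.measurableSet).inv.mul
      ((hadj i j).aemeasurable e.open_target.measurableSet)
  have hmeas : AEMeasurable (fun y => √((∑ J : Fin k → Fin n, ∑ J' : Fin k → Fin n,
      (∏ a, (gram e y)⁻¹ (J a) (J' a)) *
        (coeff e θ J y * coeff e θ J' y)) / (k.factorial : ℝ)))
      (volume.restrict e.target) := by
    refine (AEMeasurable.div_const ?_ _).sqrt
    refine Finset.aemeasurable_fun_sum _ fun J _ => Finset.aemeasurable_fun_sum _ fun J' _ => ?_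
    exact (Finset.aemeasurable_fun_prod _ fun a _ => hinv _ _).mul ((hcoef _).mul (hcoef _))
  refine hmeas.congr ?_
  filter_upwards [ae_restrict_mem e.open_target.measurableSet] with y hy
  rw [formNorm, sum_sq_eq (tangentONB (e.symm y)) _ (linearIndependent_frameMap e he hy)]
  rfl

end Measurability

section LpNorm

variable {n : ℕ} {M : Type*} [TopologicalSpace M] [ChartedSpace (Model n) M]
  [SecondCountableTopology M] [MeasurableSpace M]
  [RiemannianBundle (fun x : M => TangentSpace (𝓡 n) x)]

/-- The `L^p` norm of a form, with values in `[0, ∞]`. -/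
def eLpFormNorm {k : ℕ} (p : ℝ≥0∞) (θ : DForm n M k) : ℝ≥0∞ :=
  eLpNorm (fun x => formNorm (θ x)) p (riemVolume n M)

theorem eLpFormNorm_zero {k : ℕ} (p : ℝ≥0∞) : eLpFormNorm p (0 : DForm n M k) = 0 := by
  simp only [eLpFormNorm, Pi.zero_apply, formNorm_zero]
  exact eLpNorm_zero'

theorem eLpFormNorm_smul {k : ℕ} (p : ℝ≥0∞) (c : ℝ) (θ : DForm n M k) :
    eLpFormNorm p (c • θ) = ‖c‖ₑ * eLpFormNorm p θ := by
  simp only [eLpFormNorm, Pi.smul_apply, formNorm_smul]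
  rw [← Real.enorm_abs c]
  exact eLpNorm_const_smul |c| _ p _

theorem eLpFormNorm_add_le [IsManifold (𝓡 n) ∞ M] [BorelSpace M]
    [IsContMDiffRiemannianBundle (𝓡 n) ∞ (Model n) (fun x : M => TangentSpace (𝓡 n) x)]
    {k : ℕ} (p : ℝ≥0∞) [hp : Fact (1 ≤ p)] {θ θ' : DForm n M k}
    (h : IsLocIntegrable θ) (h' : IsLocIntegrable θ') :
    eLpFormNorm p (θ + θ') ≤ eLpFormNorm p θ + eLpFormNorm p θ' := by
  refine le_trans (eLpNorm_mono_real fun x => ?_)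
    (eLpNorm_add_le (aemeasurable_formNorm h).aestronglyMeasurable
      (aemeasurable_formNorm h').aestronglyMeasurable hp.out)
  rw [Real.norm_of_nonneg (formNorm_nonneg _)]
  exact formNorm_add_le _ _

end LpNorm

section Cohomology

variable {n : ℕ} {M : Type*} [TopologicalSpace M] [ChartedSpace (Model n) M]
  [IsManifold (𝓡 n) ∞ M] [SecondCountableTopology M] [MeasurableSpace M] [BorelSpace M]
  [RiemannianBundle (fun x : M => TangentSpace (𝓡 n) x)]
  [IsContMDiffRiemannianBundle (𝓡 n) ∞ (Model n) (fun x : M => TangentSpace (𝓡 n) x)]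

/-- The vector space of the `L^1_loc` forms with finite `L^p` norm. -/
def lpSubmodule (n : ℕ) (M : Type*) [TopologicalSpace M] [ChartedSpace (Model n) M]
    [IsManifold (𝓡 n) ∞ M] [SecondCountableTopology M] [MeasurableSpace M] [BorelSpace M]
    [RiemannianBundle (fun x : M => TangentSpace (𝓡 n) x)]
    [IsContMDiffRiemannianBundle (𝓡 n) ∞ (Model n) (fun x : M => TangentSpace (𝓡 n) x)]
    (p : ℝ≥0∞) [Fact (1 ≤ p)] (k : ℕ) : Submodule ℝ (DForm n M k) where
  carrier := {θ | IsLocIntegrable θ ∧ eLpFormNorm p θ < (⊤ : ℝ≥0∞)}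
  add_mem' := fun {θ θ'} h h' => ⟨h.1.add h'.1,
    (eLpFormNorm_add_le p h.1 h'.1).trans_lt (ENNReal.add_lt_top.2 ⟨h.2, h'.2⟩)⟩
  zero_mem' := ⟨IsLocIntegrable.zero, by
    rw [eLpFormNorm_zero]
    exact ENNReal.zero_lt_top⟩
  smul_mem' := fun c θ h => ⟨h.1.smul c, by
    rw [eLpFormNorm_smul]
    exact ENNReal.mul_lt_top enorm_lt_top h.2⟩

/-- The space `L^p(M, Λ^k)` with its norm `(∫ |θ|^p)^(1/p)`. Its elements are forms, not classes of
forms modulo equality almost everywhere, so that it is a seminormed space; two forms represent the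
same element of the associated normed space if and only if they are at distance `0`. -/
def LpForm (n : ℕ) (M : Type*) [TopologicalSpace M] [ChartedSpace (Model n) M]
    [IsManifold (𝓡 n) ∞ M] [SecondCountableTopology M] [MeasurableSpace M] [BorelSpace M]
    [RiemannianBundle (fun x : M => TangentSpace (𝓡 n) x)]
    [IsContMDiffRiemannianBundle (𝓡 n) ∞ (Model n) (fun x : M => TangentSpace (𝓡 n) x)]
    (p : ℝ≥0∞) [Fact (1 ≤ p)] (k : ℕ) : Type _ :=
  lpSubmodule n M p k

variable {p q : ℝ≥0∞} [Fact (1 ≤ p)] [Fact (1 ≤ q)] {k : ℕ}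

instance instAddCommGroupLpForm : AddCommGroup (LpForm n M p k) :=
  inferInstanceAs (AddCommGroup (lpSubmodule n M p k))

instance instModuleLpForm : Module ℝ (LpForm n M p k) :=
  inferInstanceAs (Module ℝ (lpSubmodule n M p k))

/-- The differential form underlying an element of `L^p`. -/
def LpForm.form : LpForm n M p k →ₗ[ℝ] DForm n M k := (lpSubmodule n M p k).subtype

instance instNormLpForm : Norm (LpForm n M p k) := ⟨fun θ => (eLpFormNorm p θ.form).toReal⟩

theorem LpForm.norm_def (θ : LpForm n M p k) : ‖θ‖ = (eLpFormNorm p θ.form).toReal := rfl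

theorem LpForm.isLocIntegrable (θ : LpForm n M p k) : IsLocIntegrable θ.form := θ.2.1

theorem LpForm.eLpFormNorm_lt_top (θ : LpForm n M p k) : eLpFormNorm p θ.form < (⊤ : ℝ≥0∞) :=
  θ.2.2

theorem LpForm.norm_smul_eq (c : ℝ) (θ : LpForm n M p k) : ‖c • θ‖ = ‖c‖ * ‖θ‖ := by
  rw [LpForm.norm_def, map_smul, eLpFormNorm_smul, ENNReal.toReal_mul, toReal_enorm,
    LpForm.norm_def]

theorem LpForm.norm_add_le (θ θ' : LpForm n M p k) : ‖θ + θ'‖ ≤ ‖θ‖ + ‖θ'‖ := by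
  simp only [LpForm.norm_def, map_add]
  rw [← ENNReal.toReal_add θ.eLpFormNorm_lt_top.ne θ'.eLpFormNorm_lt_top.ne]
  exact ENNReal.toReal_mono
    (ENNReal.add_lt_top.2 ⟨θ.eLpFormNorm_lt_top, θ'.eLpFormNorm_lt_top⟩).ne
    (eLpFormNorm_add_le p θ.isLocIntegrable θ'.isLocIntegrable)

instance instSeminormedLpForm : SeminormedAddCommGroup (LpForm n M p k) :=
  SeminormedAddCommGroup.ofCore (𝕜 := ℝ)
    { norm_nonneg := fun _ => ENNReal.toReal_nonneg
      norm_smul := LpForm.norm_smul_eq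
      norm_triangle := LpForm.norm_add_le }

instance instNormedSpaceLpForm : NormedSpace ℝ (LpForm n M p k) where
  norm_smul_le c θ := (LpForm.norm_smul_eq c θ).le

/-- `Z^k_p(M)`: the weakly closed forms in `L^p`. -/
def closedForms (o : OrientedAtlas n M) (p : ℝ≥0∞) [Fact (1 ≤ p)] (k : ℕ) :
    Submodule ℝ (LpForm n M p k) where
  carrier := {θ | IsWeakDeriv o θ.form 0}
  add_mem' := fun {θ θ'} h h' => by
    simpa using IsWeakDeriv.add (o := o) h h'
  zero_mem' := by
    simpa using IsWeakDeriv.zero o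
  smul_mem' := fun c θ h => by
    simpa using IsWeakDeriv.smul (o := o) c h

/-- `B^k_{q,p}(M)`: the forms of degree `k` in `L^p` that are the weak differential of a form of
degree `k - 1` in `L^q`. In degree `0` this is the zero subspace of `L^p`, that is, the space of the
forms of norm `0`. -/
def exactForms (o : OrientedAtlas n M) (q p : ℝ≥0∞) [Fact (1 ≤ q)] [Fact (1 ≤ p)] :
    (k : ℕ) → Submodule ℝ (LpForm n M p k)
  | 0 => (⊥ : Submodule ℝ (LpForm n M p 0)).topologicalClosure
  | j + 1 =>
    { carrier := {θ | ∃ β : LpForm n M q j, IsWeakDeriv o β.form θ.form}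
      add_mem' := by
        rintro θ θ' ⟨β, h⟩ ⟨β', h'⟩
        exact ⟨β + β', by simpa using h.add h'⟩
      zero_mem' := ⟨0, by simpa using IsWeakDeriv.zero o⟩
      smul_mem' := by
        rintro c θ ⟨β, h⟩
        exact ⟨c • β, by simpa using h.smul c⟩ }

/-- The `L_{q,p}`-cohomology `H^k_{q,p}(M) = Z^k_p(M) / B^k_{q,p}(M)`. -/
abbrev Cohomology (o : OrientedAtlas n M) (q p : ℝ≥0∞) [Fact (1 ≤ q)] [Fact (1 ≤ p)] (k : ℕ) :
    Type _ :=
  closedForms o p k ⧸ (exactForms o q p k).comap (closedForms o p k).subtype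

/-- The reduced `L_{q,p}`-cohomology: the quotient of `Z^k_p(M)` by the closure of `B^k_{q,p}(M)`,
with the quotient norm. -/
abbrev ReducedCohomology (o : OrientedAtlas n M) (q p : ℝ≥0∞) [Fact (1 ≤ q)] [Fact (1 ≤ p)]
    (k : ℕ) : Type _ :=
  closedForms o p k ⧸ (exactForms o q p k).topologicalClosure.comap (closedForms o p k).subtype

/-- `Ω^j_{q,p}(M)`: the forms of degree `j` in `L^q` whose weak differential is in `L^p`. Such a
form `β` is given together with its differential, as the pair `(β, dβ)`, and the norm is
`max (‖β‖_q, ‖dβ‖_p)`. -/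
def Omega (o : OrientedAtlas n M) (q p : ℝ≥0∞) [Fact (1 ≤ q)] [Fact (1 ≤ p)] (j : ℕ) :
    Submodule ℝ (LpForm n M q j × LpForm n M p (j + 1)) where
  carrier := {z | IsWeakDeriv o z.1.form z.2.form}
  add_mem' := fun {z z'} h h' => by
    simpa using IsWeakDeriv.add (o := o) h h'
  zero_mem' := by
    simpa using IsWeakDeriv.zero o
  smul_mem' := fun c z h => by
    simpa using IsWeakDeriv.smul (o := o) c h

end Cohomology

section Distortion

/-- The `k`-th principal invariant `σ_k` of a linear map between Euclidean spaces: the `k`-th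
elementary symmetric polynomial in its singular values. -/
def principalInvariant {V W : Type*} [NormedAddCommGroup V] [InnerProductSpace ℝ V]
    [FiniteDimensional ℝ V] [NormedAddCommGroup W] [InnerProductSpace ℝ W]
    [FiniteDimensional ℝ W] (k : ℕ) (A : V →ₗ[ℝ] W) : ℝ :=
  ∑ s ∈ (Finset.range (Module.finrank ℝ V)).powersetCard k, ∏ i ∈ s, A.singularValues i

variable {n : ℕ} {M N : Type*}
  [TopologicalSpace M] [ChartedSpace (Model n) M] [SecondCountableTopology M] [MeasurableSpace M]
  [RiemannianBundle (fun x : M => TangentSpace (𝓡 n) x)]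
  [TopologicalSpace N] [ChartedSpace (Model n) N]
  [RiemannianBundle (fun x : N => TangentSpace (𝓡 n) x)]

/-- `σ_k(f, x) = σ_k(df_x)`. -/
def sigma (k : ℕ) (f : M ≃ₘ^∞⟮𝓡 n, 𝓡 n⟯ N) (x : M) : ℝ :=
  principalInvariant k (mfderiv (𝓡 n) (𝓡 n) f x).toLinearMap

/-- The Jacobian `J_f = σ_n(f)`, the product of all the singular values of the differential. -/
def jacobian (f : M ≃ₘ^∞⟮𝓡 n, 𝓡 n⟯ N) (x : M) : ℝ := sigma n f x

/-- `f ∈ BD^k_{(s,t)}(M, N)`: the diffeomorphism `f` has bounded `(s,t)`-distortion in degree `k`,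
that is, `σ_k(f)^s / J_f` belongs to `L^t(M)`, where `1 ≤ s < ∞` and `0 < t ≤ ∞`. -/
def BoundedDistortion (k : ℕ) (s : ℝ) (t : ℝ≥0∞) (f : M ≃ₘ^∞⟮𝓡 n, 𝓡 n⟯ N) : Prop :=
  1 ≤ s ∧ 0 < t ∧ MemLp (fun x => sigma k f x ^ s * (jacobian f x)⁻¹) t (riemVolume n M)

end Distortion

end

end LqpCohomology

open LqpCohomology

open scoped Topology

/-! The proof combines two pointwise estimates, Hölder's inequality and the naturality of the weak
differential. Let `f : M → N`. The singular value decomposition of `df_x` gives orthonormal bases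
`u`, `w` with `df_x(u_i) = s_i w_i`, so `(f^*α)(u_I) = s_I α(w_I)`, where `s_I` is the product of
the `s_i` over `I`. Since `s_I` is one term of `σ_k`, `|f^*α| ≤ σ_k |α|` (`formNorm_pullback_le`).
Since `J_f = s_I s_{I^c}` and `s_{I^c}` is one term of `σ_{n-k}`, also `J_f |α| ≤ σ_{n-k} |f^*α|`
(`jacobian_mul_formNorm_le`).

By the change of variables `riemVolume_eq_map`, the `L^{p'}` norm of `θ` on `N` is that of `J^{1/p'}
|θ|∘f` on `M`. The first estimate reads `|f^*θ| ≤ (σ_k^{p'}/J)^{1/p'} · J^{1/p'} |θ|∘f`, and the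
exponent `t` is the one for which Hölder's inequality bounds `f^*` from `L^{p'}` to `L^p`
(`exists_eLpFormNorm_pullback_le`). With `s = q'/(q'-1)`, the second reads `J^{1/q'} |θ|∘f ≤
(σ_{n-j}^s/J)^{1/s} |f^*θ|`, and `r` is the exponent for which `f^*θ ∈ L^q` forces `θ ∈ L^{q'}`
(`exists_eLpFormNorm_le_pullback`).

Pullback commutes with the weak differential (`IsWeakDeriv.pullback`): test forms on `M` are the
pullbacks of test forms on `N`, `f^*` respects wedge products and `d`, and a reversal of orientation
is a locally constant sign that the test form absorbs.

For (B), if `f^*ω = dβ` then `ω = d((f⁻¹)^*β)`, and the second estimate places `(f⁻¹)^*β` in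
`L^{q'}`. For (C), `f^*` is bounded in degrees `k-1` and `k` and commutes with `d`, so it maps exact
forms to exact forms and, by continuity, the closure into the closure. -/

namespace LqpCohomology

noncomputable section

/-! ### Singular values and the norm of covectors -/

section LinearAlgebra

variable {n : ℕ} {V W : Type*} [NormedAddCommGroup V] [InnerProductSpace ℝ V]
  [NormedAddCommGroup W] [InnerProductSpace ℝ W]

theorem gram_sum_smul {ι : Type*} [Fintype ι] (P : Matrix ι ι ℝ) (w : ι → W) :
    Matrix.gram ℝ (fun i => ∑ j, P j i • w j) = P.transpose * Matrix.gram ℝ w * P := by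
  ext i j
  simp only [Matrix.gram_apply, Matrix.mul_apply, Matrix.transpose_apply, sum_inner, inner_sum,
    real_inner_smul_left, real_inner_smul_right, Finset.sum_mul]
  refine Finset.sum_congr rfl fun a _ => Finset.sum_congr rfl fun c _ => ?_
  rw [real_inner_comm]
  ring

theorem det_gram_sum_smul {ι : Type*} [Fintype ι] [DecidableEq ι] (P : Matrix ι ι ℝ) (w : ι → W) :
    (Matrix.gram ℝ (fun i => ∑ j, P j i • w j)).det = P.det ^ 2 * (Matrix.gram ℝ w).det := by
  rw [gram_sum_smul, Matrix.det_mul, Matrix.det_mul, Matrix.det_transpose]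
  ring

/-- In `sum_sq_eq` the Gram matrix of `b'` is the identity, so only the diagonal terms survive. This
frees `formNorm` from the chosen `tangentONB` and allows singular bases to be used instead. -/
theorem sum_sq_orthonormalBasis_eq {k : ℕ} (b b' : OrthonormalBasis (Fin n) ℝ V)
    (α : V [⋀^Fin k]→L[ℝ] ℝ) :
    ∑ i : Fin k → Fin n, (α fun a => b (i a)) ^ 2 =
      ∑ i : Fin k → Fin n, (α fun a => b' (i a)) ^ 2 := by
  classical
  have h1 : (Matrix.gram ℝ b')⁻¹ = 1 := by
    rw [Matrix.gram_eq_one_iff_orthonormal.2 b'.orthonormal, inv_one]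
  rw [sum_sq_eq b b' b'.toBasis.linearIndependent α]
  refine Finset.sum_congr rfl fun J _ => ?_
  rw [Finset.sum_eq_single J]
  · simp [h1, sq]
  · intro J' _ hJ
    obtain ⟨a, ha⟩ := Function.ne_iff.1 hJ
    rw [Finset.prod_eq_zero (Finset.mem_univ a), zero_mul]
    rw [h1, Matrix.one_apply_ne ha.symm]
  · simp

/-- The sums in `formNorm` run over all multi-indices. Those with a repetition must be discarded,
because a product of singular values with repeated factors is not a term of `σ_k`. -/
theorem apply_eq_zero_of_not_injective {k : ℕ} (w : Fin n → W) (α : W [⋀^Fin k]→L[ℝ] ℝ)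
    {I : Fin k → Fin n} (hI : ¬ Function.Injective I) : (α fun a => w (I a)) = 0 := by
  obtain ⟨a, a', h, hne⟩ : ∃ a a', I a = I a' ∧ a ≠ a' := by
    simpa [Function.Injective] using hI
  exact α.map_eq_zero_of_eq _ (by simp [h]) hne

variable [FiniteDimensional ℝ V] [FiniteDimensional ℝ W]

theorem principalInvariant_finrank_eq_normDet (hV : Module.finrank ℝ V = n) (A : V →ₗ[ℝ] W) :
    principalInvariant n A = A.normDet := by
  rw [LinearMap.normDet_eq_prod_singularValues, principalInvariant, hV]
  have : (Finset.range n).powersetCard n = {Finset.range n} := by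
    conv_lhs => rw [← Finset.card_range n, Finset.card_range n]
    simpa using Finset.powersetCard_self (Finset.range n)
  rw [this, Finset.sum_singleton]

/-- Expanding `v` in an orthonormal basis multiplies both Gram determinants by the same `(det P)²`,
and on that basis the claim is the formula for `normDet`. This is how the Riemannian density
acquires the factor `J_f`. -/
theorem det_gram_map (hV : Module.finrank ℝ V = n) (A : V →ₗ[ℝ] W) (v : Fin n → V) :
    (Matrix.gram ℝ fun i => A (v i)).det =
      principalInvariant n A ^ 2 * (Matrix.gram ℝ v).det := by
  let b := (stdOrthonormalBasis ℝ V).reindex (finCongr hV)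
  let P : Matrix (Fin n) (Fin n) ℝ := Matrix.of fun j i => inner ℝ (b j) (v i)
  have hv : v = fun i => ∑ j, P j i • b j := funext fun i => (b.sum_repr' (v i)).symm
  have hAv : (fun i => A (v i)) = fun i => ∑ j, P j i • A (b j) := by
    funext i
    conv_lhs => rw [hv]
    simp
  rw [hAv, det_gram_sum_smul, hv, det_gram_sum_smul,
    Matrix.gram_eq_one_iff_orthonormal.2 b.orthonormal,
    principalInvariant_finrank_eq_normDet hV A]
  have := LinearMap.normDet_sq_eq_det_gram A b
  simp only [Matrix.det_one, mul_one]
  have h2 : (Matrix.gram ℝ fun j => A (b j)).det = A.normDet ^ 2 := by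
    simpa [Function.comp_def] using this.symm
  rw [h2, mul_comm]

/-- The singular value decomposition of an injective linear map between spaces of the same
dimension. -/
theorem exists_singular_bases (hV : Module.finrank ℝ V = n) (hW : Module.finrank ℝ W = n)
    (A : V →ₗ[ℝ] W) (hA : Function.Injective A) :
    ∃ (u : OrthonormalBasis (Fin n) ℝ V) (w : OrthonormalBasis (Fin n) ℝ W),
      (∀ i : Fin n, 0 < A.singularValues i) ∧ ∀ i : Fin n, A (u i) = A.singularValues i • w i := by
  have hpos : ∀ i : Fin n, 0 < A.singularValues i := fun i =>
    A.injective_iff_forall_lt_finrank_singularValues_pos.1 hA i (by rw [hV]; exact i.2)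
  -- The images under `A` of the eigenvectors of `A*A` are orthogonal with lengths the singular
  -- values; normalised, they form the second basis.
  let u := A.isSymmetric_adjoint_comp_self.eigenvectorBasis hV
  have hu : ∀ i j, inner ℝ (A (u i)) (A (u j)) =
      A.singularValues i ^ 2 * inner ℝ (u i) (u j) := by
    intro i j
    have h := A.isSymmetric_adjoint_comp_self.apply_eigenvectorBasis hV i
    rw [← LinearMap.adjoint_inner_left, ← LinearMap.comp_apply, h, real_inner_smul_left,
      A.sq_singularValues_fin hV]
    rfl
  have hon : Orthonormal ℝ fun i : Fin n => (A.singularValues i)⁻¹ • A (u i) := by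
    rw [orthonormal_iff_ite]
    intro i j
    rw [real_inner_smul_left, real_inner_smul_right, hu, orthonormal_iff_ite.1 u.orthonormal]
    split_ifs with h
    · subst h
      field_simp [(hpos i).ne']
    · simp
  refine ⟨u, OrthonormalBasis.mk hon
    (hon.linearIndependent.span_eq_top_of_card_eq_finrank' (by simp [hW])).ge, hpos, fun i => ?_⟩
  simp [smul_smul, (hpos i).ne']

theorem prod_singularValues_le_principalInvariant (hV : Module.finrank ℝ V = n) (A : V →ₗ[ℝ] W)
    (S : Finset (Fin n)) : ∏ i ∈ S, A.singularValues i ≤ principalInvariant S.card A := by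
  rw [principalInvariant, hV]
  -- The product over `S` is one of the nonnegative terms of the elementary symmetric polynomial,
  -- whose index sets lie in `ℕ`.
  have h := Finset.single_le_sum (f := fun s => ∏ i ∈ s, A.singularValues i)
    (s := (Finset.range n).powersetCard S.card) (a := S.map Fin.valEmbedding)
    (fun s _ => Finset.prod_nonneg fun i _ => A.singularValues_nonneg i) (by
      rw [Finset.mem_powersetCard]
      refine ⟨fun i hi => ?_, by simp⟩
      obtain ⟨j, -, rfl⟩ := Finset.mem_map.1 hi
      simp)
  simpa using h

theorem principalInvariant_nonneg (k : ℕ) (A : V →ₗ[ℝ] W) : 0 ≤ principalInvariant k A :=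
  Finset.sum_nonneg fun _ _ => Finset.prod_nonneg fun i _ => A.singularValues_nonneg i

theorem principalInvariant_finrank_eq_prod (hV : Module.finrank ℝ V = n) (A : V →ₗ[ℝ] W) :
    principalInvariant n A = ∏ i : Fin n, A.singularValues i := by
  rw [principalInvariant_finrank_eq_normDet hV, LinearMap.normDet_eq_prod_singularValues, hV,
    Finset.prod_range]

theorem principalInvariant_finrank_pos (hV : Module.finrank ℝ V = n) (A : V →ₗ[ℝ] W)
    (hA : Function.Injective A) : 0 < principalInvariant n A := by
  rw [principalInvariant_finrank_eq_prod hV]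
  exact Finset.prod_pos fun i _ =>
    A.injective_iff_forall_lt_finrank_singularValues_pos.1 hA i (by rw [hV]; exact i.2)

theorem apply_map_singular_basis {k : ℕ} {A : V →ₗ[ℝ] W} {u : Fin n → V} {w : Fin n → W}
    (h : ∀ i : Fin n, A (u i) = A.singularValues i • w i) (α : W [⋀^Fin k]→L[ℝ] ℝ)
    (I : Fin k → Fin n) :
    (α fun a => A (u (I a))) = (∏ a, A.singularValues (I a)) * α fun a => w (I a) := by
  simp_rw [h]
  simpa using α.toMultilinearMap.map_smul_univ (fun a => A.singularValues (I a))
    (fun a => w (I a))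

/-- In singular bases the inequality holds term by term: the coefficient of index `I` is multiplied
by `s_I ≤ σ_k`. -/
theorem sum_sq_map_le {k : ℕ} (hV : Module.finrank ℝ V = n) (hW : Module.finrank ℝ W = n)
    (A : V →L[ℝ] W) (hA : Function.Injective A) (b : OrthonormalBasis (Fin n) ℝ V)
    (b' : OrthonormalBasis (Fin n) ℝ W) (α : W [⋀^Fin k]→L[ℝ] ℝ) :
    ∑ i : Fin k → Fin n, (α fun a => A (b (i a))) ^ 2 ≤
      principalInvariant k A.toLinearMap ^ 2 * ∑ i : Fin k → Fin n, (α fun a => b' (i a)) ^ 2 := by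
  obtain ⟨u, w, -, h⟩ := exists_singular_bases hV hW A.toLinearMap hA
  have h1 := sum_sq_orthonormalBasis_eq b u (α.compContinuousLinearMap A)
  simp only [ContinuousAlternatingMap.compContinuousLinearMap_apply, Function.comp_def] at h1
  rw [h1, sum_sq_orthonormalBasis_eq b' w α, Finset.mul_sum]
  refine Finset.sum_le_sum fun I _ => ?_
  have h2 := apply_map_singular_basis h α I
  rw [ContinuousLinearMap.coe_coe] at h2
  rw [h2]
  by_cases hI : Function.Injective I
  · rw [mul_pow]
    gcongr
    · exact Finset.prod_nonneg fun a _ => LinearMap.singularValues_nonneg _ _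
    have := prod_singularValues_le_principalInvariant hV A.toLinearMap
      (Finset.univ.map ⟨I, hI⟩)
    simpa using this
  · simp [apply_eq_zero_of_not_injective (w ·) α hI]

/-- Again term by term, from `σ_n = s_{I^c} s_I` and `s_{I^c} ≤ σ_{n-k}`. If `k > n`, no multi-index
is injective and both sums vanish, so the truncated `n - k` is harmless. -/
theorem principalInvariant_sq_mul_sum_sq_le {k : ℕ} (hV : Module.finrank ℝ V = n)
    (hW : Module.finrank ℝ W = n) (A : V →L[ℝ] W) (hA : Function.Injective A)
    (b : OrthonormalBasis (Fin n) ℝ V) (b' : OrthonormalBasis (Fin n) ℝ W)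
    (α : W [⋀^Fin k]→L[ℝ] ℝ) :
    principalInvariant n A.toLinearMap ^ 2 * ∑ i : Fin k → Fin n, (α fun a => b' (i a)) ^ 2 ≤
      principalInvariant (n - k) A.toLinearMap ^ 2 *
        ∑ i : Fin k → Fin n, (α fun a => A (b (i a))) ^ 2 := by
  classical
  obtain ⟨u, w, -, h⟩ := exists_singular_bases hV hW A.toLinearMap hA
  have h1 := sum_sq_orthonormalBasis_eq b u (α.compContinuousLinearMap A)
  simp only [ContinuousAlternatingMap.compContinuousLinearMap_apply, Function.comp_def] at h1
  rw [h1, sum_sq_orthonormalBasis_eq b' w α, Finset.mul_sum, Finset.mul_sum]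
  refine Finset.sum_le_sum fun I _ => ?_
  have h2 := apply_map_singular_basis h α I
  rw [ContinuousLinearMap.coe_coe] at h2
  rw [h2]
  by_cases hI : Function.Injective I
  · rw [mul_pow _ (α _), ← mul_assoc, ← mul_pow (principalInvariant (n - k) _)]
    gcongr
    · exact principalInvariant_nonneg _ _
    rw [principalInvariant_finrank_eq_prod hV]
    set S : Finset (Fin n) := Finset.univ.map ⟨I, hI⟩ with hS
    have hle := prod_singularValues_le_principalInvariant hV A.toLinearMap Sᶜ
    rw [Finset.card_compl, Fintype.card_fin, hS, Finset.card_map, Finset.card_univ,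
      Fintype.card_fin, ← hS] at hle
    rw [← Finset.prod_compl_mul_prod S]
    have hprod : ∏ i ∈ S, A.toLinearMap.singularValues i =
        ∏ a, A.toLinearMap.singularValues (I a) := by simp [hS]
    rw [hprod]
    exact mul_le_mul_of_nonneg_right hle
      (Finset.prod_nonneg fun a _ => LinearMap.singularValues_nonneg _ _)
  · simp [apply_eq_zero_of_not_injective (w ·) α hI]

end LinearAlgebra

/-! ### Forms in charts, changes of charts, and charts carried along by a diffeomorphism -/

section Charts

variable {n : ℕ} {M : Type*} [TopologicalSpace M] [ChartedSpace (Model n) M]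
  {N : Type*} [TopologicalSpace N] [ChartedSpace (Model n) N]

section ChangeOfCharts

variable {e e' : Chart n M}

theorem mdifferentiable_of_mem_maximalAtlas (he : e ∈ IsManifold.maximalAtlas (𝓡 n) ∞ M) :
    e.MDifferentiable (𝓡 n) (𝓡 n) :=
  ⟨(contMDiffOn_of_mem_maximalAtlas he).mdifferentiableOn (by norm_num),
    (contMDiffOn_symm_of_mem_maximalAtlas he).mdifferentiableOn (by norm_num)⟩

theorem contDiffOn_transition (he : e ∈ IsManifold.maximalAtlas (𝓡 n) ∞ M)
    (he' : e' ∈ IsManifold.maximalAtlas (𝓡 n) ∞ M) :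
    ContDiffOn ℝ ∞ (e' ∘ e.symm) (e.symm.trans e').source := by
  rw [← contMDiffOn_iff_contDiffOn]
  refine (contMDiffOn_of_mem_maximalAtlas he').comp
    ((contMDiffOn_symm_of_mem_maximalAtlas he).mono ?_) ?_
  · intro y hy
    simp at hy
    exact hy.1
  · intro y hy
    simp at hy
    exact hy.2

theorem frameMap_bijective (he : e ∈ IsManifold.maximalAtlas (𝓡 n) ∞ M) {y : Model n}
    (hy : y ∈ e.target) : Function.Bijective (frameMap e y) :=
  (mdifferentiable_of_mem_maximalAtlas he).symm.mfderiv_bijective hy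

theorem inChart_injective (he : e ∈ IsManifold.maximalAtlas (𝓡 n) ∞ M) {y : Model n}
    (hy : y ∈ e.target) {k : ℕ} {θ θ' : DForm n M k} (h : inChart e θ y = inChart e θ' y) :
    θ (e.symm y) = θ' (e.symm y) := by
  ext v
  choose w hw using fun a => (frameMap_bijective he hy).surjective (v a)
  have := congrArg (fun α => α w) h
  simpa [inChart, Function.comp_def, hw] using this

theorem fderiv_transition (he : e ∈ IsManifold.maximalAtlas (𝓡 n) ∞ M)
    (he' : e' ∈ IsManifold.maximalAtlas (𝓡 n) ∞ M) {y : Model n}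
    (hy : y ∈ (e.symm.trans e').source) (v : Model n) :
    fderiv ℝ (e' ∘ e.symm) y v = mfderiv (𝓡 n) (𝓡 n) e' (e.symm y) (frameMap e y v) := by
  simp at hy
  rw [← mfderiv_eq_fderiv, mfderiv_comp (I' := 𝓡 n) y
    ((mdifferentiable_of_mem_maximalAtlas he').mdifferentiableAt hy.2)
    ((mdifferentiable_of_mem_maximalAtlas he).mdifferentiableAt_symm hy.1)]
  rfl

/-- The two vectors live in the tangent spaces at `e.symm (e x)` and at `x`, which are different
types indexed by equal points; hence `HEq`. `DForm.congr_heq` and `gram_congr_heq` then remove it.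
-/
theorem frameMap_mfderiv (he : e ∈ IsManifold.maximalAtlas (𝓡 n) ∞ M) {x : M}
    (hx : x ∈ e.source) (v : TangentSpace (𝓡 n) x) :
    HEq (frameMap e (e x) (mfderiv (𝓡 n) (𝓡 n) e x v)) v := by
  have h := (mdifferentiable_of_mem_maximalAtlas he).symm_comp_deriv hx
  have h2 := congrArg (fun A => A v) h
  exact heq_of_eq h2

theorem frameMap_transition (he : e ∈ IsManifold.maximalAtlas (𝓡 n) ∞ M)
    (he' : e' ∈ IsManifold.maximalAtlas (𝓡 n) ∞ M) {y : Model n}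
    (hy : y ∈ (e.symm.trans e').source) (v : Model n) :
    HEq (frameMap e' (e' (e.symm y)) (fderiv ℝ (e' ∘ e.symm) y v)) (frameMap e y v) := by
  rw [fderiv_transition he he' hy]
  simp at hy
  exact frameMap_mfderiv he' hy.2 _

theorem DForm.congr_heq {k : ℕ} (θ : DForm n M k) {x x' : M} (h : x = x')
    {v : Fin k → TangentSpace (𝓡 n) x} {v' : Fin k → TangentSpace (𝓡 n) x'}
    (hv : ∀ a, HEq (v a) (v' a)) : θ x v = θ x' v' := by
  subst h
  exact congrArg (θ x) (funext fun a => eq_of_heq (hv a))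

theorem inChart_transition (he : e ∈ IsManifold.maximalAtlas (𝓡 n) ∞ M)
    (he' : e' ∈ IsManifold.maximalAtlas (𝓡 n) ∞ M) {y : Model n}
    (hy : y ∈ (e.symm.trans e').source) {k : ℕ} (θ : DForm n M k) :
    inChart e θ y =
      (inChart e' θ ((e' ∘ e.symm) y)).compContinuousLinearMap (fderiv ℝ (e' ∘ e.symm) y) := by
  ext v
  have hy' := hy
  simp only [OpenPartialHomeomorph.trans_source, OpenPartialHomeomorph.symm_source,
    Set.mem_inter_iff, Set.mem_preimage] at hy'
  exact (θ.congr_heq (e'.left_inv hy'.2) fun a => frameMap_transition he he' hy (v a)).symm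

theorem gram_congr_heq [RiemannianBundle (fun x : M => TangentSpace (𝓡 n) x)] {ι : Type*}
    {x x' : M} (h : x = x') {v : ι → TangentSpace (𝓡 n) x} {v' : ι → TangentSpace (𝓡 n) x'}
    (hv : ∀ a, HEq (v a) (v' a)) : Matrix.gram ℝ v = Matrix.gram ℝ v' := by
  subst h
  rw [show v = v' from funext fun a => eq_of_heq (hv a)]

theorem gram_transition [RiemannianBundle (fun x : M => TangentSpace (𝓡 n) x)]
    (he : e ∈ IsManifold.maximalAtlas (𝓡 n) ∞ M)
    (he' : e' ∈ IsManifold.maximalAtlas (𝓡 n) ∞ M) {y : Model n}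
    (hy : y ∈ (e.symm.trans e').source) :
    gram e y = Matrix.gram ℝ fun i => frameMap e' ((e' ∘ e.symm) y)
      (fderiv ℝ (e' ∘ e.symm) y (EuclideanSpace.single i 1)) := by
  have hy' := hy
  simp only [OpenPartialHomeomorph.trans_source, OpenPartialHomeomorph.symm_source,
    Set.mem_inter_iff, Set.mem_preimage] at hy'
  exact gram_congr_heq (e'.left_inv hy'.2).symm fun i =>
    (frameMap_transition he he' hy (EuclideanSpace.single i 1)).symm

/-- The coordinate frame of `e` is that of `e'` multiplied by the Jacobian matrix of the transition
map, so `det_gram_sum_smul` applies. -/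
theorem det_gram_transition [RiemannianBundle (fun x : M => TangentSpace (𝓡 n) x)]
    (he : e ∈ IsManifold.maximalAtlas (𝓡 n) ∞ M)
    (he' : e' ∈ IsManifold.maximalAtlas (𝓡 n) ∞ M) {y : Model n}
    (hy : y ∈ (e.symm.trans e').source) :
    (gram e y).det = (fderiv ℝ (e' ∘ e.symm) y).det ^ 2 * (gram e' ((e' ∘ e.symm) y)).det := by
  set A := fderiv ℝ (e' ∘ e.symm) y
  let b := (EuclideanSpace.basisFun (Fin n) ℝ).toBasis
  have h : ∀ i, frameMap e' ((e' ∘ e.symm) y) (A (EuclideanSpace.single i 1)) =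
      ∑ j, LinearMap.toMatrix b b A.toLinearMap j i •
        frameMap e' ((e' ∘ e.symm) y) (EuclideanSpace.single j 1) := by
    intro i
    have h1 : A (EuclideanSpace.single i 1) =
        ∑ j, LinearMap.toMatrix b b A.toLinearMap j i • EuclideanSpace.single j (1 : ℝ) := by
      have := b.sum_repr (A (b i))
      simp only [LinearMap.toMatrix_apply]
      simpa [b] using this.symm
    rw [h1]
    exact (map_sum _ _ _).trans (Finset.sum_congr rfl fun j _ => map_smul _ _ _)
  rw [gram_transition he he' hy, show (fun i => frameMap e' ((e' ∘ e.symm) y)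
    (fderiv ℝ (e' ∘ e.symm) y (EuclideanSpace.single i 1))) = _ from funext h,
    det_gram_sum_smul, LinearMap.det_toMatrix]
  rfl

end ChangeOfCharts

section Smooth

/-- `extD` uses a different preferred chart at each point. The result is the same in every chart
because the exterior derivative on the model commutes with pullback under the smooth transition
maps. -/
theorem inChart_extD [IsManifold (𝓡 n) ∞ M] {e : Chart n M}
    (he : e ∈ IsManifold.maximalAtlas (𝓡 n) ∞ M) {k : ℕ}
    {η : DForm n M k} (hη : IsSmoothForm η) {y : Model n} (hy : y ∈ e.target) :
    inChart e (extD η) y = extDeriv (inChart e η) y := by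
  set x := e.symm y with hx
  set e₀ := chartAt (Model n) x with he₀
  have hm : e₀ ∈ IsManifold.maximalAtlas (𝓡 n) ∞ M := IsManifold.chart_mem_maximalAtlas x
  have hys : y ∈ (e.symm.trans e₀).source := by
    simp only [OpenPartialHomeomorph.trans_source, OpenPartialHomeomorph.symm_source,
      Set.mem_inter_iff, Set.mem_preimage]
    exact ⟨hy, mem_chart_source _ x⟩
  have hnhds := (e.symm.trans e₀).open_source.mem_nhds hys
  have heq : inChart e η =ᶠ[𝓝 y] fun z =>
      (inChart e₀ η ((e₀ ∘ e.symm) z)).compContinuousLinearMap (fderiv ℝ (e₀ ∘ e.symm) z) :=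
    Filter.eventually_of_mem hnhds fun z hz => inChart_transition he hm hz η
  have hd : DifferentiableAt ℝ (inChart e₀ η) ((e₀ ∘ e.symm) y) :=
    ((hη e₀ hm).contDiffAt (e₀.open_target.mem_nhds (e₀.map_source (mem_chart_source _ x)))
      ).differentiableAt (by norm_num)
  rw [heq.extDeriv_eq, extDeriv_pullback hd
    ((contDiffOn_transition he hm).contDiffAt hnhds) (by simpa using ENat.LEInfty.out)]
  ext v
  exact congrArg (extDeriv (inChart e₀ η) (e₀ x))
    (funext fun a => (fderiv_transition he hm hys (v a)).symm)

theorem IsSmoothForm.smul_of_locallyConstant {k : ℕ} {η : DForm n M k} (hη : IsSmoothForm η)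
    {c : M → ℝ} (hc : IsLocallyConstant c) : IsSmoothForm (fun x => c x • η x : DForm n M k) := by
  intro e he y hy
  have h1 : ∀ᶠ z in 𝓝[e.target] y, c (e.symm z) = c (e.symm y) :=
    ((e.continuousOn_symm y hy).tendsto.eventually ((hc.eventually_eq (e.symm y))))
  refine ((hη e he y hy).const_smul (c (e.symm y))).congr_of_eventuallyEq ?_ rfl
  filter_upwards [h1] with z hz
  simp only [inChart, hz]
  rfl

/-- Near each point the factor is a constant. It will be the sign that compares two orientations,
and this sign may differ between components. -/
theorem extD_smul_of_locallyConstant {k : ℕ} (η : DForm n M k)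
    {c : M → ℝ} (hc : IsLocallyConstant c) :
    extD (fun x => c x • η x : DForm n M k) = fun x => c x • extD η x := by
  funext x
  set e := chartAt (Model n) x with he
  have hx : e x ∈ e.target := e.map_source (mem_chart_source _ x)
  have hxx : e.symm (e x) = x := e.left_inv (mem_chart_source _ x)
  have h1 : ∀ᶠ z in 𝓝 (e x), c (e.symm z) = c x := by
    have h2 := (e.continuousAt_symm hx).tendsto
    rw [hxx] at h2
    exact h2.eventually (hc.eventually_eq x)
  have h3 : inChart e (fun x => c x • η x : DForm n M k) =ᶠ[𝓝 (e x)]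
      fun z => c x • inChart e η z := by
    filter_upwards [h1] with z hz
    simp only [inChart, hz]
    rfl
  have h4 := h3.extDeriv_eq.trans (extDeriv_smul (c x) (inChart e η))
  ext v
  exact congrArg (fun α => α fun a => mfderiv (𝓡 n) (𝓡 n) e x (v a)) h4

theorem IsTestForm.smul_of_locallyConstant {k : ℕ} {η : DForm n M k} (hη : IsTestForm η)
    {c : M → ℝ} (hc : IsLocallyConstant c) : IsTestForm (fun x => c x • η x : DForm n M k) := by
  refine ⟨hη.1.smul_of_locallyConstant hc, hη.2.of_isClosed_subset isClosed_closure
    (closure_mono fun x hx h => hx ?_)⟩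
  simp only [h, smul_zero]

end Smooth

section Transport

variable (f : M ≃ₘ^∞⟮𝓡 n, 𝓡 n⟯ N)

/-- The chart of `N` that a diffeomorphism `f : M → N` makes from a chart of `M`. -/
def transportChart (e : Chart n M) : Chart n N :=
  f.toHomeomorph.symm.transOpenPartialHomeomorph e

variable (e : Chart n M)

@[simp] theorem transportChart_apply (y : N) : transportChart f e y = e (f.symm y) := rfl

@[simp] theorem transportChart_symm_apply (y : Model n) :
    (transportChart f e).symm y = f (e.symm y) := rfl

@[simp] theorem transportChart_target : (transportChart f e).target = e.target := rfl

@[simp] theorem transportChart_source : (transportChart f e).source = f.symm ⁻¹' e.source := rfl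

variable {e : Chart n M}

theorem transportChart_mem [IsManifold (𝓡 n) ∞ N] (he : e ∈ IsManifold.maximalAtlas (𝓡 n) ∞ M) :
    transportChart f e ∈ IsManifold.maximalAtlas (𝓡 n) ∞ N := by
  rw [IsManifold.mem_maximalAtlas_iff_contMDiffOn]
  exact ⟨(contMDiffOn_of_mem_maximalAtlas he).comp f.symm.contMDiff.contMDiffOn fun y hy => hy,
    f.contMDiff.comp_contMDiffOn (contMDiffOn_symm_of_mem_maximalAtlas he)⟩

theorem frameMap_transportChart (he : e ∈ IsManifold.maximalAtlas (𝓡 n) ∞ M) {y : Model n}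
    (hy : y ∈ e.target) (v : Model n) :
    frameMap (transportChart f e) y v = mfderiv (𝓡 n) (𝓡 n) f (e.symm y) (frameMap e y v) := by
  have h := mfderiv_comp (I := 𝓡 n) (I' := 𝓡 n) (I'' := 𝓡 n) y
    (f.mdifferentiable (by norm_num) (e.symm y))
    ((mdifferentiable_of_mem_maximalAtlas he).mdifferentiableAt_symm hy)
  exact congrArg (fun A => A v) h

/-- Read in the charts `e` and `transportChart f e`, the map `f` is the identity. Hence local
integrability, smoothness and `d` all pass to pullbacks with no computation. -/
theorem inChart_pullback (he : e ∈ IsManifold.maximalAtlas (𝓡 n) ∞ M) {y : Model n}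
    (hy : y ∈ e.target) {k : ℕ} (θ : DForm n N k) :
    inChart e (pullback f θ) y = inChart (transportChart f e) θ y := by
  ext v
  simp only [inChart, pullback, ContinuousAlternatingMap.compContinuousLinearMap_apply,
    Function.comp_def, frameMap_transportChart f he hy]
  rfl

theorem coeff_pullback (he : e ∈ IsManifold.maximalAtlas (𝓡 n) ∞ M) {y : Model n}
    (hy : y ∈ e.target) {k : ℕ} (θ : DForm n N k) (i : Fin k → Fin n) :
    coeff e (pullback f θ) i y = coeff (transportChart f e) θ i y :=
  congrArg (fun α => α fun a => EuclideanSpace.single (i a) 1) (inChart_pullback f he hy θ)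

theorem IsLocIntegrable.pullback [IsManifold (𝓡 n) ∞ N] {k : ℕ} {θ : DForm n N k}
    (hθ : IsLocIntegrable θ) :
    IsLocIntegrable (pullback f θ) := by
  intro e he i
  have h := hθ _ (transportChart_mem f he) i
  rw [transportChart_target] at h
  refine h.congr ?_
  filter_upwards [ae_restrict_mem e.open_target.measurableSet] with y hy
  exact (coeff_pullback f he hy θ i).symm

theorem IsSmoothForm.pullback [IsManifold (𝓡 n) ∞ N] {k : ℕ} {θ : DForm n N k}
    (hθ : IsSmoothForm θ) :
    IsSmoothForm (pullback f θ) := by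
  intro e he
  exact (hθ _ (transportChart_mem f he)).congr fun y hy => inChart_pullback f he hy θ

theorem IsTestForm.pullback [IsManifold (𝓡 n) ∞ N] {k : ℕ} {θ : DForm n N k} (hθ : IsTestForm θ) :
    IsTestForm (pullback f θ) := by
  refine ⟨hθ.1.pullback f, (f.toHomeomorph.isCompact_preimage.2 hθ.2).of_isClosed_subset
    isClosed_closure (closure_minimal (fun x hx => subset_closure fun h => hx ?_)
      (isClosed_closure.preimage f.continuous))⟩
  change θ (f x) = 0 at h
  simp only [LqpCohomology.pullback, h]
  rfl

theorem extD_pullback [IsManifold (𝓡 n) ∞ M] [IsManifold (𝓡 n) ∞ N] {k : ℕ} {θ : DForm n N k}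
    (hθ : IsSmoothForm θ) :
    extD (pullback f θ) = pullback f (extD θ) := by
  funext x
  set e := chartAt (Model n) x with he
  have hm : e ∈ IsManifold.maximalAtlas (𝓡 n) ∞ M := IsManifold.chart_mem_maximalAtlas x
  have hx : e x ∈ e.target := e.map_source (mem_chart_source _ x)
  have hxx : e.symm (e x) = x := e.left_inv (mem_chart_source _ x)
  have key : inChart e (extD (pullback f θ)) (e x) = inChart e (pullback f (extD θ)) (e x) := by
    rw [inChart_extD hm (hθ.pullback f) hx, inChart_pullback f hm hx,
      inChart_extD (transportChart_mem f hm) hθ hx]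
    refine Filter.EventuallyEq.extDeriv_eq ?_
    exact Filter.eventually_of_mem (e.open_target.mem_nhds hx)
      fun z hz => inChart_pullback f hm hz θ
  have := inChart_injective hm hx key
  rwa [hxx] at this

theorem pullback_symm_pullback {k : ℕ} (θ : DForm n N k) :
    pullback f.symm (pullback f θ) = θ := by
  funext y
  ext v
  have h : (mfderiv (𝓡 n) (𝓡 n) f (f.symm y)).comp (mfderiv (𝓡 n) (𝓡 n) f.symm y) =
      mfderiv (𝓡 n) (𝓡 n) (f ∘ f.symm) y :=
    (mfderiv_comp y (f.mdifferentiable (by norm_num) _)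
      (f.symm.mdifferentiable (by norm_num) y)).symm
  have h2 : (f ∘ f.symm : N → N) = id := funext fun z => f.apply_symm_apply z
  rw [h2, mfderiv_id] at h
  refine θ.congr_heq (f.apply_symm_apply y) fun a => ?_
  exact heq_of_eq (congrArg (fun A => A (v a)) h)

theorem mfderiv_injective (x : M) : Function.Injective (mfderiv (𝓡 n) (𝓡 n) f x) := by
  have h : (mfderiv (𝓡 n) (𝓡 n) f.symm (f x)).comp (mfderiv (𝓡 n) (𝓡 n) f x) =
      mfderiv (𝓡 n) (𝓡 n) (f.symm ∘ f) x :=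
    (mfderiv_comp x (f.symm.mdifferentiable (by norm_num) _)
      (f.mdifferentiable (by norm_num) x)).symm
  have h2 : (f.symm ∘ f : M → M) = id := funext fun z => f.symm_apply_apply z
  rw [h2, mfderiv_id] at h
  intro v w hvw
  have h3 : ∀ u, mfderiv (𝓡 n) (𝓡 n) f.symm (f x) (mfderiv (𝓡 n) (𝓡 n) f x u) = u :=
    fun u => congrArg (fun A => A u) h
  have h4 := congrArg (mfderiv (𝓡 n) (𝓡 n) f.symm (f x)) hvw
  exact (h3 v).symm.trans (h4.trans (h3 w))

end Transport

end Charts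

/-! ### The countable partition that underlies the Riemannian volume -/

section Pieces

variable {n : ℕ} {M : Type*} [TopologicalSpace M] [ChartedSpace (Model n) M]
  [SecondCountableTopology M]

theorem disjoint_piece : Pairwise (Function.onFun Disjoint (piece (n := n) (M := M))) := by
  have key : ∀ c c' : centers n M, Encodable.encode c < Encodable.encode c' →
      Disjoint (piece c) (piece c') := by
    intro c c' h
    rw [Set.disjoint_left]
    intro x hx hx'
    exact hx'.2 (Set.mem_iUnion₂.2 ⟨c, h, hx.1⟩)
  intro c c' h
  rcases lt_trichotomy (Encodable.encode c) (Encodable.encode c') with h1 | h1 | h1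
  · exact key c c' h1
  · exact absurd (Encodable.encode_injective h1) h
  · exact (key c' c h1).symm

theorem iUnion_centers_source :
    ⋃ c : centers n M, (chartAt (Model n) (c : M)).source = Set.univ := by
  have h := (exists_countable_charts n M).choose_spec.2
  rwa [Set.biUnion_eq_iUnion] at h

theorem iUnion_piece : ⋃ c : centers n M, piece c = Set.univ := by
  refine Set.eq_univ_of_forall fun x => ?_
  have hx : {c : centers n M | x ∈ (chartAt (Model n) (c : M)).source}.Nonempty := by
    have := (iUnion_centers_source (n := n) (M := M)).ge (Set.mem_univ x)
    exact Set.mem_iUnion.1 this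
  -- The point lies in the piece of the chart with the smallest code among those whose domain
  -- contains it.
  have hmin := hx.image Encodable.encode
  obtain ⟨c, hc, hce⟩ := Nat.sInf_mem hmin
  refine Set.mem_iUnion.2 ⟨c, hc, fun h => ?_⟩
  obtain ⟨c', hlt, hc'⟩ := Set.mem_iUnion₂.1 h
  have hle := Nat.sInf_le (Set.mem_image_of_mem Encodable.encode
    (show c' ∈ {c : centers n M | x ∈ (chartAt (Model n) (c : M)).source} from hc'))
  omega

theorem measurableSet_piece [MeasurableSpace M] [BorelSpace M] (c : centers n M) :
    MeasurableSet (piece c) :=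
  (chartAt (Model n) (c : M)).open_source.measurableSet.diff
    (MeasurableSet.iUnion fun c' => MeasurableSet.iUnion fun _ =>
      (chartAt (Model n) (c' : M)).open_source.measurableSet)

end Pieces

/-! ### Independence of the Riemannian volume from the charts -/

section Volume

variable {n : ℕ} {M : Type*} [TopologicalSpace M] [ChartedSpace (Model n) M]
  [IsManifold (𝓡 n) ∞ M] [MeasurableSpace M] [BorelSpace M]
  [RiemannianBundle (fun x : M => TangentSpace (𝓡 n) x)]
  [IsContMDiffRiemannianBundle (𝓡 n) ∞ (Model n) (fun x : M => TangentSpace (𝓡 n) x)]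

theorem lintegral_chartVolume {e : Chart n M} (he : e ∈ IsManifold.maximalAtlas (𝓡 n) ∞ M)
    {g : M → ℝ≥0∞} (hg : Measurable g) :
    ∫⁻ x, g x ∂chartVolume e =
      ∫⁻ y in e.target, ENNReal.ofReal √(gram e y).det * g (e.symm y) := by
  have hsymm : AEMeasurable e.symm (volume.restrict e.target) :=
    e.continuousOn_symm.aemeasurable e.open_target.measurableSet
  have hdet : AEMeasurable (fun y => ENNReal.ofReal √(gram e y).det)
      (volume.restrict e.target) :=
    ((Continuous.comp_continuousOn (continuous_id.matrix_det) (continuousOn_gram e he)).aemeasurable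
      e.open_target.measurableSet).sqrt.ennreal_ofReal
  rw [chartVolume, lintegral_map' hg.aemeasurable
    (hsymm.mono_ac (withDensity_absolutelyContinuous _ _)),
    lintegral_withDensity_eq_lintegral_mul₀ (g := fun y => g (e.symm y)) hdet
      (hg.comp_aemeasurable hsymm)]
  rfl

theorem chartVolume_apply {e : Chart n M} (he : e ∈ IsManifold.maximalAtlas (𝓡 n) ∞ M)
    {s : Set M} (hs : MeasurableSet s) :
    chartVolume e s =
      ∫⁻ y in e.target, ENNReal.ofReal √(gram e y).det * s.indicator 1 (e.symm y) := by
  rw [← lintegral_chartVolume he (measurable_one.indicator hs), lintegral_indicator_one hs]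

/-- The Euclidean change of variables along the transition map produces `|det dφ|`, which is the
factor relating the two densities `√det g`. -/
theorem chartVolume_eq_chartVolume {e e' : Chart n M}
    (he : e ∈ IsManifold.maximalAtlas (𝓡 n) ∞ M) (he' : e' ∈ IsManifold.maximalAtlas (𝓡 n) ∞ M)
    {s : Set M} (hs : MeasurableSet s) (hse : s ⊆ e.source) (hse' : s ⊆ e'.source) :
    chartVolume e s = chartVolume e' s := by
  -- Since `s` lies in the other chart domain, only the part of the target that meets this domain
  -- contributes.
  have key : ∀ {a b : Chart n M}, s ⊆ b.source →
      ∫⁻ y in a.target, ENNReal.ofReal √(gram a y).det * s.indicator 1 (a.symm y) =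
        ∫⁻ y in (a.symm.trans b).source,
          ENNReal.ofReal √(gram a y).det * s.indicator 1 (a.symm y) := by
    intro a b hb
    have hsub : (a.symm.trans b).source ⊆ a.target := fun y hy => by
      rw [OpenPartialHomeomorph.trans_source] at hy
      exact hy.1
    rw [← lintegral_indicator a.open_target.measurableSet,
      ← lintegral_indicator (a.symm.trans b).open_source.measurableSet]
    refine lintegral_congr fun y => ?_
    by_cases hy : y ∈ (a.symm.trans b).source
    · rw [Set.indicator_of_mem hy, Set.indicator_of_mem (hsub hy)]
    rw [Set.indicator_of_notMem hy, Set.indicator_apply_eq_zero]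
    intro hya
    rw [Set.indicator_of_notMem, mul_zero]
    intro h
    rw [OpenPartialHomeomorph.trans_source] at hy
    exact hy ⟨hya, hb h⟩
  rw [chartVolume_apply he hs, chartVolume_apply he' hs, key hse', key hse]
  set φ := e.symm.trans e' with hφ
  have hφt : (e'.symm.trans e).source = φ '' φ.source := by
    rw [φ.image_source_eq_target]
    simp [hφ]
  rw [hφt, lintegral_image_eq_lintegral_abs_det_fderiv_mul volume φ.open_source.measurableSet
    (f' := fderiv ℝ (e' ∘ e.symm)) ?_ φ.injOn]
  · refine setLIntegral_congr_fun φ.open_source.measurableSet fun y hy => ?_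
    have hy' := hy
    simp only [hφ, OpenPartialHomeomorph.trans_source, OpenPartialHomeomorph.symm_source,
      Set.mem_inter_iff, Set.mem_preimage] at hy'
    have h1 : e'.symm (φ y) = e.symm y := e'.left_inv hy'.2
    have h2 : (gram e y).det = _ := det_gram_transition he he' hy
    rw [h1, h2, Real.sqrt_mul (sq_nonneg _), Real.sqrt_sq_eq_abs,
      ENNReal.ofReal_mul (abs_nonneg _), mul_assoc]
    rfl
  · intro y hy
    exact (((contDiffOn_transition he he').contDiffAt (φ.open_source.mem_nhds hy)).differentiableAt
      (by norm_num)).hasFDerivAt.hasFDerivWithinAt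

variable [SecondCountableTopology M]

/-- In any admissible chart, the Riemannian volume has the density `√det(g_{ij})`. -/
theorem riemVolume_apply_of_subset_source {e : Chart n M}
    (he : e ∈ IsManifold.maximalAtlas (𝓡 n) ∞ M) {s : Set M} (hs : MeasurableSet s)
    (hse : s ⊆ e.source) : riemVolume n M s = chartVolume e s := by
  have h1 : s = ⋃ c : centers n M, s ∩ piece c := by
    rw [← Set.inter_iUnion, iUnion_piece, Set.inter_univ]
  rw [riemVolume, Measure.sum_apply _ hs]
  conv_rhs => rw [h1, measure_iUnion
    (fun c c' h => (disjoint_piece h).mono Set.inter_subset_right Set.inter_subset_right)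
    (fun c => hs.inter (measurableSet_piece c))]
  refine tsum_congr fun c => ?_
  rw [Measure.restrict_apply hs]
  exact chartVolume_eq_chartVolume (IsManifold.chart_mem_maximalAtlas _) he
    (hs.inter (measurableSet_piece c)) (fun x hx => hx.2.1) (Set.inter_subset_left.trans hse)

theorem restrict_riemVolume {e : Chart n M} (he : e ∈ IsManifold.maximalAtlas (𝓡 n) ∞ M)
    {s : Set M} (hs : MeasurableSet s) (hse : s ⊆ e.source) :
    (riemVolume n M).restrict s = (chartVolume e).restrict s := by
  ext t ht
  rw [Measure.restrict_apply ht, Measure.restrict_apply ht]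
  exact riemVolume_apply_of_subset_source he (ht.inter hs) (Set.inter_subset_right.trans hse)

end Volume

/-! ### The change of variables formula for a diffeomorphism -/

section ChangeOfVariables

variable {n : ℕ} {M N : Type*} [TopologicalSpace M] [ChartedSpace (Model n) M]
  [RiemannianBundle (fun x : M => TangentSpace (𝓡 n) x)]
  [TopologicalSpace N] [ChartedSpace (Model n) N]
  [RiemannianBundle (fun x : N => TangentSpace (𝓡 n) x)]
  (f : M ≃ₘ^∞⟮𝓡 n, 𝓡 n⟯ N)

theorem jacobian_pos (x : M) : 0 < jacobian f x :=
  principalInvariant_finrank_pos (V := TangentSpace (𝓡 n) x) (W := TangentSpace (𝓡 n) (f x))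
    (finrank_tangent x) (mfderiv (𝓡 n) (𝓡 n) f x).toLinearMap (mfderiv_injective f x)

theorem det_gram_transportChart {e : Chart n M} (he : e ∈ IsManifold.maximalAtlas (𝓡 n) ∞ M)
    {y : Model n} (hy : y ∈ e.target) :
    (gram (transportChart f e) y).det = jacobian f (e.symm y) ^ 2 * (gram e y).det := by
  have h := det_gram_map (V := TangentSpace (𝓡 n) (e.symm y))
    (W := TangentSpace (𝓡 n) (f (e.symm y))) (finrank_tangent (e.symm y))
    (mfderiv (𝓡 n) (𝓡 n) f (e.symm y)).toLinearMap
    (fun i => frameMap e y (EuclideanSpace.single i 1))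
  refine Eq.trans ?_ h
  have h2 : (fun i => frameMap (transportChart f e) y (EuclideanSpace.single i 1)) =
      fun i => mfderiv (𝓡 n) (𝓡 n) f (e.symm y) (frameMap e y (EuclideanSpace.single i 1)) :=
    funext fun i => frameMap_transportChart f he hy _
  exact congrArg (fun v => (Matrix.gram ℝ (E := TangentSpace (𝓡 n) (f (e.symm y))) v).det) h2

theorem sqrt_det_gram_transportChart {e : Chart n M}
    (he : e ∈ IsManifold.maximalAtlas (𝓡 n) ∞ M) {y : Model n} (hy : y ∈ e.target) :
    √(gram (transportChart f e) y).det = jacobian f (e.symm y) * √(gram e y).det := by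
  rw [det_gram_transportChart f he hy, Real.sqrt_mul (sq_nonneg _),
    Real.sqrt_sq (jacobian_pos f _).le]

theorem det_gram_pos [IsManifold (𝓡 n) ∞ M] {e : Chart n M}
    (he : e ∈ IsManifold.maximalAtlas (𝓡 n) ∞ M) {y : Model n} (hy : y ∈ e.target) :
    0 < (gram e y).det :=
  (Matrix.posDef_gram_of_linearIndependent (linearIndependent_frameMap e he hy)).det_pos

variable [IsManifold (𝓡 n) ∞ M]
  [IsContMDiffRiemannianBundle (𝓡 n) ∞ (Model n) (fun x : M => TangentSpace (𝓡 n) x)]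
  [IsManifold (𝓡 n) ∞ N]
  [IsContMDiffRiemannianBundle (𝓡 n) ∞ (Model n) (fun x : N => TangentSpace (𝓡 n) x)]

/-- Locally `J_f` is the quotient of the densities `√det g` of the charts `transportChart f e` and
`e`, so continuity of the singular values is not needed. -/
theorem continuous_jacobian : Continuous (jacobian f) := by
  rw [continuous_iff_continuousAt]
  intro x
  set e := chartAt (Model n) x with hec
  have he : e ∈ IsManifold.maximalAtlas (𝓡 n) ∞ M := IsManifold.chart_mem_maximalAtlas x
  have hx : x ∈ e.source := mem_chart_source _ x
  have hdet : ContinuousOn (fun y => √(gram e y).det) e.target :=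
    (continuous_id.matrix_det.comp_continuousOn (continuousOn_gram e he)).sqrt
  have hdet' : ContinuousOn (fun y => √(gram (transportChart f e) y).det) e.target :=
    (continuous_id.matrix_det.comp_continuousOn
      (continuousOn_gram _ (transportChart_mem f he))).sqrt
  have h := (hdet'.div hdet fun y hy => (Real.sqrt_pos.2 (det_gram_pos he hy)).ne').comp
    e.continuousOn e.mapsTo
  refine (h.congr fun z hz => ?_).continuousAt (e.open_source.mem_nhds hx)
  have hz' := e.map_source hz
  simp only [Function.comp_apply, Pi.div_apply]
  rw [sqrt_det_gram_transportChart f he hz', e.left_inv hz,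
    mul_div_cancel_right₀ _ (Real.sqrt_pos.2 (det_gram_pos he hz')).ne']

variable [MeasurableSpace M] [BorelSpace M] [SecondCountableTopology M]
  [MeasurableSpace N] [BorelSpace N] [SecondCountableTopology N]

/-- The change of variables formula for a diffeomorphism. -/
theorem riemVolume_eq_map : riemVolume n N =
    ((riemVolume n M).withDensity fun x => ENNReal.ofReal (jacobian f x)).map f := by
  have hJ : Measurable fun x => ENNReal.ofReal (jacobian f x) :=
    (continuous_jacobian f).measurable.ennreal_ofReal
  have hcov : ⋃ c : centers n M, (transportChart f (chartAt (Model n) (c : M))).source =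
      Set.univ := by
    -- The measures are compared on the transported charts, where both become integrals over the
    -- same set `e.target`, with densities that differ by the factor `J_f`.
    simp only [transportChart_source, ← Set.preimage_iUnion, iUnion_centers_source,
      Set.preimage_univ]
  refine (Measure.ext_iff_of_iUnion_eq_univ hcov).2 fun c => ?_
  set e := chartAt (Model n) (c : M)
  have he : e ∈ IsManifold.maximalAtlas (𝓡 n) ∞ M := IsManifold.chart_mem_maximalAtlas _
  ext t ht
  rw [Measure.restrict_apply ht, Measure.restrict_apply ht]
  set s := t ∩ (transportChart f e).source with hs
  have hsm : MeasurableSet s := ht.inter (transportChart f e).open_source.measurableSet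
  have hfs : MeasurableSet (f ⁻¹' s) := f.continuous.measurable hsm
  have hsub : f ⁻¹' s ⊆ e.source := by
    intro x hx
    have := hx.2
    simpa using this
  rw [riemVolume_apply_of_subset_source (transportChart_mem f he) hsm Set.inter_subset_right,
    chartVolume_apply (transportChart_mem f he) hsm, Measure.map_apply f.continuous.measurable hsm,
    withDensity_apply _ hfs, restrict_riemVolume he hfs hsub, ← lintegral_indicator hfs,
    lintegral_chartVolume he (hJ.indicator hfs)]
  refine setLIntegral_congr_fun e.open_target.measurableSet fun y hy => ?_
  rw [sqrt_det_gram_transportChart f he hy, ENNReal.ofReal_mul (jacobian_pos f _).le]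
  by_cases h : f (e.symm y) ∈ s
  · rw [transportChart_symm_apply, Set.indicator_of_mem h,
      Set.indicator_of_mem (show _ ∈ f ⁻¹' s from h)]
    simp [mul_comm]
  · rw [transportChart_symm_apply, Set.indicator_of_notMem h,
      Set.indicator_of_notMem (show _ ∉ f ⁻¹' s from h)]
    simp

end ChangeOfVariables

/-! ### Wedge products, scalar factors and pullback -/

theorem domCoprod_compLinearMap {R V W : Type*} [CommRing R] [AddCommGroup V] [Module R V]
    [AddCommGroup W] [Module R W] {ι κ : Type*} [Fintype ι] [Fintype κ] [DecidableEq ι]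
    [DecidableEq κ] (a : W [⋀^ι]→ₗ[R] R) (b : W [⋀^κ]→ₗ[R] R) (g : V →ₗ[R] W) (v : ι ⊕ κ → V) :
    (a.compLinearMap g).domCoprod (b.compLinearMap g) v = a.domCoprod b fun i => g (v i) := by
  simp only [← AlternatingMap.coe_multilinearMap, AlternatingMap.domCoprod_coe,
    sum_apply]
  refine Finset.sum_congr rfl fun σ _ => ?_
  -- The sum runs over classes of permutations modulo block permutations; for a representative both
  -- summands are the same expression.
  induction σ using Quotient.inductionOn' with | _ σ
  rfl

section Forms

variable {n : ℕ} {M : Type*} [TopologicalSpace M] [ChartedSpace (Model n) M]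
  {N : Type*} [TopologicalSpace N] [ChartedSpace (Model n) N]

theorem wedge_smul_right {k l : ℕ} (θ : DForm n M k) (η : DForm n M l) (c : M → ℝ) (x : M) :
    wedge θ (fun x => c x • η x : DForm n M l) x = c x • wedge θ η x := by
  have h := congrArg (fun z => ((LinearMap.mul' ℝ ℝ).compAlternatingMap z).domDomCongr
    finSumFinEquiv) ((AlternatingMap.domCoprod' (R' := ℝ)).map_smul (c x)
      ((θ x).toAlternatingMap ⊗ₜ[ℝ] (η x).toAlternatingMap))
  simp only [← TensorProduct.tmul_smul, AlternatingMap.domCoprod'_apply] at h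
  refine h.trans ?_
  ext v
  simp [wedge]

theorem wedge_pullback (f : M ≃ₘ^∞⟮𝓡 n, 𝓡 n⟯ N) {k l : ℕ} (θ : DForm n N k) (η : DForm n N l)
    (x : M) (v : Fin (k + l) → TangentSpace (𝓡 n) x) :
    wedge (pullback f θ) (pullback f η) x v =
      wedge θ η (f x) fun a => mfderiv (𝓡 n) (𝓡 n) f x (v a) :=
  congrArg (LinearMap.mul' ℝ ℝ) (domCoprod_compLinearMap (θ (f x)).toAlternatingMap
    (η (f x)).toAlternatingMap (mfderiv (𝓡 n) (𝓡 n) f x).toLinearMap (v ∘ finSumFinEquiv))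

end Forms

theorem coe_sign_ne_zero {r : ℝ} (h : r ≠ 0) : ((SignType.sign r : SignType) : ℝ) ≠ 0 := by
  rcases lt_or_gt_of_ne h with h | h
  · simp [sign_neg h]
  · simp [sign_pos h]

/-! ### Signs of frames and comparison of orientations -/

section Orientation

variable {n : ℕ} {M : Type*} [TopologicalSpace M] [ChartedSpace (Model n) M]
  {N : Type*} [TopologicalSpace N] [ChartedSpace (Model n) N]

/-- The determinant of the coordinates, in the chart `e`, of `n` tangent vectors at `x`. -/
def frameDet (e : Chart n M) (x : M) (v : Fin n → TangentSpace (𝓡 n) x) : ℝ :=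
  Matrix.det (Matrix.of fun i j : Fin n =>
    (show Model n from mfderiv (𝓡 n) (𝓡 n) e x (v j)) i)

theorem frameDet_map {e : Chart n M} {x : M} {e' : Chart n N} {x' : N}
    {v : Fin n → TangentSpace (𝓡 n) x} {v' : Fin n → TangentSpace (𝓡 n) x'}
    (A : Model n →L[ℝ] Model n)
    (h : ∀ j, (mfderiv (𝓡 n) (𝓡 n) e' x' (v' j) : Model n) =
      A (mfderiv (𝓡 n) (𝓡 n) e x (v j) : Model n)) :
    frameDet e' x' v' = A.det * frameDet e x v := by
  let b := (EuclideanSpace.basisFun (Fin n) ℝ).toBasis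
  have hA : A.det = (LinearMap.toMatrix b b A.toLinearMap).det :=
    (LinearMap.det_toMatrix b A.toLinearMap).symm
  rw [hA, frameDet, frameDet, ← Matrix.det_mul]
  congr 1
  ext i j
  simp only [Matrix.of_apply, Matrix.mul_apply, h]
  set w : Model n := mfderiv (𝓡 n) (𝓡 n) e x (v j)
  have h1 := congrFun (LinearMap.toMatrix_mulVec_repr b b A.toLinearMap w) i
  simpa [Matrix.mulVec, dotProduct, b] using h1.symm

variable {o : OrientedAtlas n M} {e e' : Chart n M} {x : M}

theorem frameDet_transition (he : e ∈ IsManifold.maximalAtlas (𝓡 n) ∞ M)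
    (he' : e' ∈ IsManifold.maximalAtlas (𝓡 n) ∞ M) (hx : x ∈ e.source) (hx' : x ∈ e'.source)
    (v : Fin n → TangentSpace (𝓡 n) x) :
    frameDet e' x v = (fderiv ℝ (e' ∘ e.symm) (e x)).det * frameDet e x v := by
  refine frameDet_map _ fun j => ?_
  have hd := (mdifferentiable_of_mem_maximalAtlas he).mdifferentiableAt hx
  have hy : e x ∈ (e.symm.trans e').source := by
    rw [OpenPartialHomeomorph.trans_source]
    exact ⟨e.map_source hx, by simpa [e.left_inv hx] using hx'⟩
  have hφ : DifferentiableAt ℝ (e' ∘ e.symm) (e x) :=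
    ((contDiffOn_transition he he').contDiffAt
      ((e.symm.trans e').open_source.mem_nhds hy)).differentiableAt (by norm_num)
  have h1 : mfderiv (𝓡 n) (𝓡 n) ((e' ∘ e.symm) ∘ e) x =
      (mfderiv (𝓡 n) (𝓡 n) (e' ∘ e.symm) (e x)).comp (mfderiv (𝓡 n) (𝓡 n) e x) :=
    mfderiv_comp x hφ.mdifferentiableAt hd
  have h2 : (e' ∘ e.symm) ∘ e =ᶠ[𝓝 x] e' := by
    filter_upwards [e.open_source.mem_nhds hx] with z hz
    simp [e.left_inv hz]
  have h3 := h2.mfderiv_eq (I := 𝓡 n) (I' := 𝓡 n)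
  rw [mfderiv_eq_fderiv] at h1
  have h4 : ∀ w : TangentSpace (𝓡 n) x, (mfderiv (𝓡 n) (𝓡 n) ((e' ∘ e.symm) ∘ e) x w : Model n) =
      mfderiv (𝓡 n) (𝓡 n) e' x w := fun w => congrArg (fun A => A w) h3
  rw [← h4, h1]
  rfl

theorem frameDet_ne_zero (he : e ∈ IsManifold.maximalAtlas (𝓡 n) ∞ M) (hx : x ∈ e.source)
    {v : Fin n → TangentSpace (𝓡 n) x} (hv : LinearIndependent ℝ v) : frameDet e x v ≠ 0 := by
  have hinj := (mdifferentiable_of_mem_maximalAtlas he).mfderiv_injective hx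
  have h1 : LinearIndependent ℝ fun j => mfderiv (𝓡 n) (𝓡 n) e x (v j) :=
    hv.map' (mfderiv (𝓡 n) (𝓡 n) e x).toLinearMap (LinearMap.ker_eq_bot.2 hinj)
  have h2 := h1.map' (WithLp.linearEquiv 2 ℝ (Fin n → ℝ)).toLinearMap (LinearEquiv.ker _)
  have h3 := Matrix.linearIndependent_cols_iff_isUnit (A := Matrix.of fun i j : Fin n =>
    (show Model n from mfderiv (𝓡 n) (𝓡 n) e x (v j)) i)
  exact ((Matrix.isUnit_iff_isUnit_det _).1 (h3.1 h2)).ne_zero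

namespace OrientedAtlas

theorem chart_mem (o : OrientedAtlas n M) (x : M) : o.chart x ∈ o.charts :=
  (o.exists_mem_source x).choose_spec.1

theorem mem_chart_source (o : OrientedAtlas n M) (x : M) : x ∈ (o.chart x).source :=
  (o.exists_mem_source x).choose_spec.2

/-- This makes `topDensity` independent of the arbitrary positive chart chosen at `x`. -/
theorem sign_frameDet_eq (he : e ∈ o.charts) (he' : e' ∈ o.charts) (hx : x ∈ e.source)
    (hx' : x ∈ e'.source) (v : Fin n → TangentSpace (𝓡 n) x) :
    SignType.sign (frameDet e' x v) = SignType.sign (frameDet e x v) := by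
  rw [frameDet_transition (o.subset_maximalAtlas he) (o.subset_maximalAtlas he') hx hx', sign_mul,
    sign_pos (o.det_pos e he e' he' _ _), one_mul]
  rw [OpenPartialHomeomorph.trans_source]
  exact ⟨e.map_source hx, by simpa [e.left_inv hx] using hx'⟩

/-- The orientation of `N` that a diffeomorphism `f : M → N` makes from an orientation of `M`. -/
def transport [IsManifold (𝓡 n) ∞ N] (o : OrientedAtlas n M) (f : M ≃ₘ^∞⟮𝓡 n, 𝓡 n⟯ N) :
    OrientedAtlas n N where
  charts := transportChart f '' o.charts
  subset_maximalAtlas := by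
    rintro _ ⟨e, he, rfl⟩
    exact transportChart_mem f (o.subset_maximalAtlas he)
  exists_mem_source y := ⟨_, Set.mem_image_of_mem _ (o.chart_mem (f.symm y)),
    o.mem_chart_source (f.symm y)⟩
  det_pos := by
    rintro _ ⟨e, he, rfl⟩ _ ⟨e', he', rfl⟩ y hy
    have h : transportChart f e' ∘ (transportChart f e).symm = e' ∘ e.symm := by
      funext z
      simp
    rw [h]
    refine o.det_pos e he e' he' y ?_
    rw [OpenPartialHomeomorph.trans_source] at hy ⊢
    exact ⟨hy.1, by simpa using hy.2⟩

/-- The sign that compares two orientations at `x`. -/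
def relSign (o o' : OrientedAtlas n M) (x : M) : ℝ :=
  SignType.sign (fderiv ℝ (o'.chart x ∘ (o.chart x).symm) (o.chart x x)).det

theorem sign_frameDet_chart (o o' : OrientedAtlas n M) (x : M)
    (v : Fin n → TangentSpace (𝓡 n) x) :
    (SignType.sign (frameDet (o'.chart x) x v) : ℝ) =
      o.relSign o' x * SignType.sign (frameDet (o.chart x) x v) := by
  rw [frameDet_transition (o.subset_maximalAtlas (o.chart_mem x))
    (o'.subset_maximalAtlas (o'.chart_mem x)) (o.mem_chart_source x) (o'.mem_chart_source x),
    sign_mul, SignType.coe_mul, relSign]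

/-- Both signs compare the two orientations on one and the same frame, whose nonzero sign cancels.
The charts can therefore be kept fixed while the point moves. -/
theorem relSign_eq (o o' : OrientedAtlas n M) (he : e ∈ o.charts) (he' : e' ∈ o'.charts)
    (hx : x ∈ e.source) (hx' : x ∈ e'.source) :
    o.relSign o' x = SignType.sign (fderiv ℝ (e' ∘ e.symm) (e x)).det := by
  let b : Module.Basis (Fin n) ℝ (TangentSpace (𝓡 n) x) :=
    (EuclideanSpace.basisFun (Fin n) ℝ).toBasis
  have h0 := frameDet_ne_zero (o.subset_maximalAtlas he) hx b.linearIndependent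
  have h1 := o.sign_frameDet_chart o' x b
  rw [← o'.sign_frameDet_eq (o'.chart_mem x) he' (o'.mem_chart_source x) hx',
    ← o.sign_frameDet_eq (o.chart_mem x) he (o.mem_chart_source x) hx,
    frameDet_transition (o.subset_maximalAtlas he) (o'.subset_maximalAtlas he') hx hx', sign_mul,
    SignType.coe_mul] at h1
  refine (mul_right_cancel₀ ?_ h1).symm
  exact coe_sign_ne_zero h0

/-- With the charts fixed, the sign is that of a continuous determinant which does not vanish. -/
theorem isLocallyConstant_relSign (o o' : OrientedAtlas n M) :
    IsLocallyConstant (o.relSign o') := by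
  rw [IsLocallyConstant.iff_eventually_eq]
  intro x
  set e := o.chart x
  set e' := o'.chart x
  have he : e ∈ o.charts := o.chart_mem x
  have he' : e' ∈ o'.charts := o'.chart_mem x
  have hx : x ∈ e.source := o.mem_chart_source x
  have hx' : x ∈ e'.source := o'.mem_chart_source x
  have hy : e x ∈ (e.symm.trans e').source := by
    rw [OpenPartialHomeomorph.trans_source]
    exact ⟨e.map_source hx, by simpa [e.left_inv hx] using hx'⟩
  let b : Module.Basis (Fin n) ℝ (TangentSpace (𝓡 n) x) :=
    (EuclideanSpace.basisFun (Fin n) ℝ).toBasis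
  have h0 := frameDet_ne_zero (o'.subset_maximalAtlas he') hx' b.linearIndependent
  rw [frameDet_transition (o.subset_maximalAtlas he) (o'.subset_maximalAtlas he') hx hx'] at h0
  have hcont : ContinuousAt (fun z => (fderiv ℝ (e' ∘ e.symm) (e z)).det) x := by
    have h1 : ContinuousAt (fderiv ℝ (e' ∘ e.symm)) (e x) :=
      ((contDiffOn_transition (o.subset_maximalAtlas he)
        (o'.subset_maximalAtlas he')).continuousOn_fderiv_of_isOpen
        (e.symm.trans e').open_source (by norm_num)).continuousAt
        ((e.symm.trans e').open_source.mem_nhds hy)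
    have h2 : ContinuousAt (fun z => fderiv ℝ (e' ∘ e.symm) (e z)) x :=
      h1.comp (e.continuousAt hx)
    exact (ContinuousLinearMap.continuous_det.continuousAt).comp h2
  have hsign : ContinuousAt
      (fun z => SignType.sign (fderiv ℝ (e' ∘ e.symm) (e z)).det) x :=
    ContinuousAt.comp (g := SignType.sign)
      (continuousAt_sign_of_ne_zero (left_ne_zero_of_mul h0)) hcont
  filter_upwards [hsign.eventually_mem ((isOpen_discrete
      {SignType.sign (fderiv ℝ (e' ∘ e.symm) (e x)).det}).mem_nhds rfl),
    e.open_source.mem_nhds hx, e'.open_source.mem_nhds hx'] with z hz hze hze'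
  rw [relSign_eq o o' he he' hze hze', relSign_eq o o' he he' hx hx']
  exact congrArg (SignType.cast (α := ℝ)) hz

end OrientedAtlas

end Orientation

theorem measurableEmbedding_diffeomorph {n : ℕ} {M N : Type*} [TopologicalSpace M]
    [ChartedSpace (Model n) M] [TopologicalSpace N] [ChartedSpace (Model n) N] [MeasurableSpace M]
    [BorelSpace M] [MeasurableSpace N] [BorelSpace N] (f : M ≃ₘ^∞⟮𝓡 n, 𝓡 n⟯ N) :
    MeasurableEmbedding f :=
  f.toHomeomorph.measurableEmbedding

/-! ### Integrals of top forms and pullback of the weak differential -/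

section TopDegree

variable {n : ℕ} {M : Type*} [TopologicalSpace M] [ChartedSpace (Model n) M]
  [RiemannianBundle (fun x : M => TangentSpace (𝓡 n) x)]
  {N : Type*} [TopologicalSpace N] [ChartedSpace (Model n) N]
  [RiemannianBundle (fun x : N => TangentSpace (𝓡 n) x)]

/-- Write `v = bP` with `b` orthonormal. Then `√det Gram(v) = |det P|`, `η(v) = det P · η(b)`, and
the sign of the frame changes by that of `det P`. In this product form `v` need not be independent.
-/
theorem topDensity_mul_sqrt_det_gram (o : OrientedAtlas n M) {m : ℕ} (h : m = n)
    (η : ∀ x : M, TangentSpace (𝓡 n) x [⋀^Fin m]→ₗ[ℝ] ℝ) (x : M)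
    (v : Fin n → TangentSpace (𝓡 n) x) :
    topDensity o h η x * √(Matrix.gram ℝ v).det =
      SignType.sign (frameDet (o.chart x) x v) * η x fun a => v (Fin.cast h a) := by
  subst h
  let b : OrthonormalBasis (Fin m) ℝ (TangentSpace (𝓡 m) x) := tangentONB x
  let P : Matrix (Fin m) (Fin m) ℝ := b.toBasis.toMatrix v
  have hv : ∀ j, v j = ∑ i, P i j • b i := fun j => by
    simpa [P] using (b.toBasis.sum_toMatrix_smul_self v j).symm
  have hg : (Matrix.gram ℝ v).det = P.det ^ 2 := by
    rw [show v = fun j => ∑ i, P i j • b i from funext hv, det_gram_sum_smul,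
      Matrix.gram_eq_one_iff_orthonormal.2 b.orthonormal, Matrix.det_one, mul_one]
  have hη : η x v = η x b * P.det := by
    have h1 := congrArg (fun α => α v) ((η x).eq_smul_basis_det b.toBasis)
    simpa [Module.Basis.det_apply, P] using h1
  have hf : frameDet (o.chart x) x v = frameDet (o.chart x) x b * P.det := by
    rw [frameDet, frameDet, ← Matrix.det_mul]
    congr 1
    ext i j
    have h2 : (mfderiv (𝓡 m) (𝓡 m) (o.chart x) x (v j) : Model m) =
        ∑ l, P l j • (mfderiv (𝓡 m) (𝓡 m) (o.chart x) x (b l) : Model m) := by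
      rw [hv j]
      exact (map_sum _ _ _).trans (Finset.sum_congr rfl fun l _ => map_smul _ _ _)
    have h4 : ∀ (c : Fin m → ℝ) (w : Fin m → Model m),
        (∑ l, c l • w l) i = ∑ l, w l i * c l := fun c w => by simp [mul_comm]
    exact (congrArg (fun w : Model m => w i) h2).trans (h4 _ _)
  have hs : |P.det| * 1 = (SignType.sign P.det : ℝ) * P.det := by simp
  simp only [Fin.cast_eq_self]
  rw [hg, Real.sqrt_sq_eq_abs, hη, hf, sign_mul, SignType.coe_mul]
  have h3 : topDensity o rfl η x = SignType.sign (frameDet (o.chart x) x b) * η x b := rfl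
  rw [h3, ← mul_one |P.det|, hs]
  ring

theorem topDensity_change (o o' : OrientedAtlas n M) {m : ℕ} (h : m = n)
    (η : ∀ x : M, TangentSpace (𝓡 n) x [⋀^Fin m]→ₗ[ℝ] ℝ) (x : M) :
    topDensity o' h η x = o.relSign o' x * topDensity o h η x := by
  have h1 := o.sign_frameDet_chart o' x (tangentONB x)
  exact (congrArg (· * η x fun a => tangentONB x (Fin.cast h a)) h1).trans (mul_assoc _ _ _)

/-- The density at `f x` is evaluated on the image under `df_x` of an orthonormal basis, whose Gram
determinant is `J_f²`. For the transported orientation no sign appears, because the transported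
chart composed with `f` is the original chart. -/
theorem topDensity_pullback [IsManifold (𝓡 n) ∞ N] (o : OrientedAtlas n M)
    (f : M ≃ₘ^∞⟮𝓡 n, 𝓡 n⟯ N) {m : ℕ}
    (h : m = n) {η : ∀ y : N, TangentSpace (𝓡 n) y [⋀^Fin m]→ₗ[ℝ] ℝ}
    {η' : ∀ x : M, TangentSpace (𝓡 n) x [⋀^Fin m]→ₗ[ℝ] ℝ}
    (hη : ∀ x v, η' x v = η (f x) fun a => mfderiv (𝓡 n) (𝓡 n) f x (v a)) (x : M) :
    topDensity o h η' x = jacobian f x * topDensity (o.transport f) h η (f x) := by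
  have h1 := topDensity_mul_sqrt_det_gram (o.transport f) h η (f x)
    (fun j => mfderiv (𝓡 n) (𝓡 n) f x (tangentONB x j))
  have h2 : (Matrix.gram ℝ (E := TangentSpace (𝓡 n) (f x)) fun j =>
      mfderiv (𝓡 n) (𝓡 n) f x (tangentONB x j)).det = jacobian f x ^ 2 := by
    have h3 := det_gram_map (V := TangentSpace (𝓡 n) x)
      (W := TangentSpace (𝓡 n) (f x)) (finrank_tangent x)
      (mfderiv (𝓡 n) (𝓡 n) f x).toLinearMap (tangentONB x)
    rw [Matrix.gram_eq_one_iff_orthonormal.2 (tangentONB x).orthonormal, Matrix.det_one,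
      mul_one] at h3
    exact h3
  rw [h2, Real.sqrt_sq (jacobian_pos f x).le] at h1
  rw [mul_comm, h1, ← hη x fun a => tangentONB x (Fin.cast h a)]
  have hmem : transportChart f (o.chart x) ∈ (o.transport f).charts :=
    Set.mem_image_of_mem _ (o.chart_mem x)
  have hsrc : f x ∈ (transportChart f (o.chart x)).source := by
    simpa using o.mem_chart_source x
  rw [(o.transport f).sign_frameDet_eq hmem ((o.transport f).chart_mem (f x)) hsrc
    ((o.transport f).mem_chart_source (f x))]
  have h4 : mfderiv (𝓡 n) (𝓡 n) (transportChart f (o.chart x) ∘ f) x =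
      (mfderiv (𝓡 n) (𝓡 n) (transportChart f (o.chart x)) (f x)).comp
        (mfderiv (𝓡 n) (𝓡 n) f x) :=
    mfderiv_comp x ((mdifferentiable_of_mem_maximalAtlas
      ((o.transport f).subset_maximalAtlas hmem)).mdifferentiableAt hsrc)
      (f.mdifferentiable (by norm_num) x)
  have h5 : (transportChart f (o.chart x) ∘ f : M → Model n) = o.chart x := by
    funext z
    simp
  have h6 : ∀ w, (mfderiv (𝓡 n) (𝓡 n) (transportChart f (o.chart x)) (f x)
      (mfderiv (𝓡 n) (𝓡 n) f x w) : Model n) = mfderiv (𝓡 n) (𝓡 n) (o.chart x) x w := by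
    intro w
    have h7 : (mfderiv (𝓡 n) (𝓡 n) (transportChart f (o.chart x) ∘ f) x w : Model n) =
        mfderiv (𝓡 n) (𝓡 n) (o.chart x) x w := by rw [h5]
    exact (congrArg (fun A => A w) h4).symm.trans h7
  have h8 : frameDet (transportChart f (o.chart x)) (f x)
      (fun j => mfderiv (𝓡 n) (𝓡 n) f x (tangentONB x j)) =
      frameDet (o.chart x) x (tangentONB x) :=
    congrArg Matrix.det (Matrix.ext fun i j => congrArg (fun w : Model n => w i)
      (h6 (tangentONB x j)))
  rw [h8]
  rfl

variable [SecondCountableTopology M] [MeasurableSpace M]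

/-- The locally constant sign between the two densities moves onto the test form, which remains a
test form, and it commutes with `d`. Hence `f` need not preserve orientation. -/
theorem IsWeakDeriv.change_orientation {o : OrientedAtlas n M} (o' : OrientedAtlas n M) {j : ℕ}
    {β : DForm n M j} {θ : DForm n M (j + 1)} (h : IsWeakDeriv o β θ) : IsWeakDeriv o' β θ := by
  have key : ∀ {k l : ℕ} (hkl : k + l = n) (α : DForm n M k) (η : DForm n M l),
      topDensity o' hkl (wedge α η) =
        topDensity o hkl (wedge α (fun x => o.relSign o' x • η x : DForm n M l)) := by
    intro k l hkl α η
    funext x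
    rw [topDensity_change o o', topDensity, topDensity, wedge_smul_right,
      AlternatingMap.smul_apply, smul_eq_mul]
    ring
  intro l hl η hη
  have hc := o.isLocallyConstant_relSign o'
  have h1 := h l hl _ (hη.smul_of_locallyConstant hc)
  rw [extD_smul_of_locallyConstant η hc] at h1
  simpa only [TopIntegrable, topIntegral, key] using h1

variable [IsManifold (𝓡 n) ∞ M] [BorelSpace M]
  [IsContMDiffRiemannianBundle (𝓡 n) ∞ (Model n) (fun x : M => TangentSpace (𝓡 n) x)]
  [IsManifold (𝓡 n) ∞ N] [SecondCountableTopology N] [MeasurableSpace N] [BorelSpace N]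
  [IsContMDiffRiemannianBundle (𝓡 n) ∞ (Model n) (fun x : N => TangentSpace (𝓡 n) x)]
  (f : M ≃ₘ^∞⟮𝓡 n, 𝓡 n⟯ N)

theorem integrable_riemVolume_iff (g : N → ℝ) : Integrable g (riemVolume n N) ↔
    Integrable (fun x => jacobian f x * g (f x)) (riemVolume n M) := by
  rw [riemVolume_eq_map f, (measurableEmbedding_diffeomorph f).integrable_map_iff,
    integrable_withDensity_iff_integrable_smul'
      (continuous_jacobian f).measurable.ennreal_ofReal (by simp)]
  simp only [ENNReal.toReal_ofReal (jacobian_pos f _).le, smul_eq_mul, Function.comp_apply]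

theorem integral_riemVolume_eq (g : N → ℝ) : ∫ y, g y ∂riemVolume n N =
    ∫ x, jacobian f x * g (f x) ∂riemVolume n M := by
  rw [riemVolume_eq_map f, (measurableEmbedding_diffeomorph f).integral_map,
    integral_withDensity_eq_integral_toReal_smul
      (continuous_jacobian f).measurable.ennreal_ofReal (by simp)]
  simp only [ENNReal.toReal_ofReal (jacobian_pos f _).le, smul_eq_mul]

/-- The pullback under a diffeomorphism commutes with the weak differential. -/
theorem IsWeakDeriv.pullback {o : OrientedAtlas n M} {o' : OrientedAtlas n N} {j : ℕ}
    {β : DForm n N j} {θ : DForm n N (j + 1)} (h : IsWeakDeriv o' β θ) :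
    IsWeakDeriv o (pullback f β) (pullback f θ) := by
  -- With the transported orientation on `N`, `f` preserves orientation.
  have h' := h.change_orientation (o.transport f)
  intro l hl η hη
  have hη' : IsTestForm (LqpCohomology.pullback f.symm η) := hη.pullback f.symm
  set ζ := LqpCohomology.pullback f.symm η with hζ
  -- Every test form on `M` is the pullback of one on `N`, so the identity on `N` suffices.
  have hηζ : η = LqpCohomology.pullback f ζ := (pullback_symm_pullback f.symm η).symm
  have key : ∀ {k l : ℕ} (hkl : k + l = n) (α : DForm n N k) (ξ : DForm n N l),
      topDensity o hkl (wedge (LqpCohomology.pullback f α) (LqpCohomology.pullback f ξ)) =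
        fun x => jacobian f x * topDensity (o.transport f) hkl (wedge α ξ) (f x) :=
    fun hkl α ξ => funext fun x => topDensity_pullback o f hkl (wedge_pullback f α ξ) x
  have h1 := h' l hl ζ hη'
  rw [hηζ, extD_pullback f hη'.1]
  simpa only [TopIntegrable, topIntegral, key, integrable_riemVolume_iff f,
    integral_riemVolume_eq f] using h1

end TopDegree

/-! ### Hölder exponents -/

section Exponents

/-- The relation `1/(t/a) + 1/q = 1/r` forces `t/a = qr/(q-r)`, with `t = ∞` in the limit case `r =
q`. -/
theorem holderTriple_rpow_ofReal {q r : ℝ} (hr : 0 < r) (hrq : r ≤ q) {t : ℝ≥0∞} {a : ℝ}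
    (ha : 0 < a) (ht : r = q → t = ⊤) (ht' : r < q → t = ENNReal.ofReal (a * (q * r / (q - r)))) :
    ENNReal.HolderTriple (t / ENNReal.ofReal a) (ENNReal.ofReal q) (ENNReal.ofReal r) := by
  have hq : 0 < q := hr.trans_le hrq
  constructor
  rcases hrq.eq_or_lt with h | h
  · rw [ht h, ENNReal.top_div_of_ne_top ENNReal.ofReal_ne_top, ENNReal.inv_top, zero_add, h]
  · have hqr : 0 < q - r := sub_pos.2 h
    rw [ht' h, ← ENNReal.ofReal_div_of_pos ha, ← ENNReal.ofReal_inv_of_pos (by positivity),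
      ← ENNReal.ofReal_inv_of_pos hq, ← ENNReal.ofReal_inv_of_pos hr,
      ← ENNReal.ofReal_add (by positivity) (by positivity)]
    congr 1
    field_simp
    ring

/-- Here `a = 1/p'`, so that `t/a = pp'/(p'-p)`. For `p = p'` division in `ℝ≥0∞` gives `∞`, as the
convention on fractions requires. -/
theorem holderTriple_pullback {p p' : ℝ≥0∞} (h1 : 1 ≤ p) (hp : p ≤ p') (hp' : p' < ⊤) :
    ENNReal.HolderTriple (p / (p' - p) / ENNReal.ofReal (1 / p'.toReal)) p' p := by
  obtain ⟨y, hy, rfl⟩ : ∃ y : ℝ, 0 ≤ y ∧ p' = ENNReal.ofReal y :=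
    ⟨p'.toReal, ENNReal.toReal_nonneg, (ENNReal.ofReal_toReal hp'.ne).symm⟩
  obtain ⟨x, hx, rfl⟩ : ∃ x : ℝ, 0 ≤ x ∧ p = ENNReal.ofReal x :=
    ⟨p.toReal, ENNReal.toReal_nonneg, (ENNReal.ofReal_toReal (hp.trans_lt hp').ne).symm⟩
  have hx1 : 1 ≤ x := ENNReal.one_le_ofReal.1 h1
  have hxy : x ≤ y := (ENNReal.ofReal_le_ofReal_iff hy).1 hp
  have hy0 : 0 < y := by linarith
  rw [ENNReal.toReal_ofReal hy]
  refine holderTriple_rpow_ofReal (by linarith) hxy (by positivity) ?_ ?_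
  · rintro rfl
    rw [tsub_self, ENNReal.div_zero]
    exact (ENNReal.ofReal_pos.2 (by linarith)).ne'
  · intro h
    rw [← ENNReal.ofReal_sub _ hx, ← ENNReal.ofReal_div_of_pos (sub_pos.2 h)]
    congr 1
    have : y - x ≠ 0 := (sub_pos.2 h).ne'
    field_simp

/-- Here `a = (q'-1)/q'` is the reciprocal of the conjugate exponent of `q'`; it cancels the factor
`q' - 1` and leaves `qq'/(q-q')`. -/
theorem holderTriple_pushforward {q q' : ℝ≥0∞} (h1 : 1 < q') (hq : q' ≤ q) (hq' : q < ⊤) :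
    ENNReal.HolderTriple
      (q * (q' - 1) / (q - q') / ENNReal.ofReal ((q'.toReal - 1) / q'.toReal)) q q' := by
  obtain ⟨y, hy, rfl⟩ : ∃ y : ℝ, 0 ≤ y ∧ q = ENNReal.ofReal y :=
    ⟨q.toReal, ENNReal.toReal_nonneg, (ENNReal.ofReal_toReal hq'.ne).symm⟩
  obtain ⟨x, hx, rfl⟩ : ∃ x : ℝ, 0 ≤ x ∧ q' = ENNReal.ofReal x :=
    ⟨q'.toReal, ENNReal.toReal_nonneg, (ENNReal.ofReal_toReal (hq.trans_lt hq').ne).symm⟩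
  have hx1 : 1 < x := ENNReal.one_lt_ofReal.1 h1
  have hxy : x ≤ y := (ENNReal.ofReal_le_ofReal_iff hy).1 hq
  have hy0 : 0 < y := by linarith
  have hx0 : 0 < x - 1 := by linarith
  rw [ENNReal.toReal_ofReal hx, ← ENNReal.ofReal_one, ← ENNReal.ofReal_sub _ zero_le_one,
    ← ENNReal.ofReal_mul hy]
  refine holderTriple_rpow_ofReal (by linarith) hxy (by positivity) ?_ ?_
  · rintro rfl
    rw [tsub_self, ENNReal.div_zero]
    exact (ENNReal.ofReal_pos.2 (by positivity)).ne'
  · intro h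
    rw [← ENNReal.ofReal_sub _ hx, ← ENNReal.ofReal_div_of_pos (sub_pos.2 h)]
    congr 1
    have : y - x ≠ 0 := (sub_pos.2 h).ne'
    field_simp

/-- Hölder's inequality, with the `L^{t/a}` norm of `|h|^a` equal to `‖h‖_t^a`. It will be used with
`h = σ^s/J` and `a = 1/s`. -/
theorem eLpNorm_le_of_le_rpow_mul {α : Type*} [MeasurableSpace α] {μ : Measure α}
    {h B F : α → ℝ} {a : ℝ} {t p r : ℝ≥0∞} (ha : 0 < a)
    [ENNReal.HolderTriple (t / ENNReal.ofReal a) p r] (hh : AEStronglyMeasurable h μ)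
    (hB : AEStronglyMeasurable B μ) (hF : ∀ x, ‖F x‖ ≤ ‖h x‖ ^ a * ‖B x‖) :
    eLpNorm F r μ ≤ eLpNorm h t μ ^ a * eLpNorm B p μ := by
  have h1 : eLpNorm (fun x => ‖h x‖ ^ a) (t / ENNReal.ofReal a) μ = eLpNorm h t μ ^ a := by
    rw [eLpNorm_norm_rpow _ ha, ENNReal.div_mul_cancel (ENNReal.ofReal_pos.2 ha).ne'
      ENNReal.ofReal_ne_top]
  rw [← h1]
  refine le_trans ?_ (eLpNorm_smul_le_mul_eLpNorm (r := r) hB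
    (hh.norm.aemeasurable.pow_const a).aestronglyMeasurable)
  refine eLpNorm_mono fun x => (hF x).trans_eq ?_
  rw [Pi.smul_apply', norm_smul, Real.norm_of_nonneg (by positivity : 0 ≤ ‖h x‖ ^ a)]

end Exponents

/-! ### Norm estimates for pullbacks -/

section Norms

variable {n : ℕ} {M N : Type*} [TopologicalSpace M] [ChartedSpace (Model n) M]
  [RiemannianBundle (fun x : M => TangentSpace (𝓡 n) x)]
  [TopologicalSpace N] [ChartedSpace (Model n) N]
  [RiemannianBundle (fun x : N => TangentSpace (𝓡 n) x)]
  (f : M ≃ₘ^∞⟮𝓡 n, 𝓡 n⟯ N)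

theorem sigma_nonneg (k : ℕ) (x : M) : 0 ≤ sigma k f x :=
  principalInvariant_nonneg (V := TangentSpace (𝓡 n) x) (W := TangentSpace (𝓡 n) (f x)) k
    (mfderiv (𝓡 n) (𝓡 n) f x).toLinearMap

theorem formNorm_pullback_le {k : ℕ} (θ : DForm n N k) (x : M) :
    formNorm (pullback f θ x) ≤ sigma k f x * formNorm (θ (f x)) := by
  have h := sum_sq_map_le (V := TangentSpace (𝓡 n) x) (W := TangentSpace (𝓡 n) (f x))
    (finrank_tangent x) (finrank_tangent (f x)) (mfderiv (𝓡 n) (𝓡 n) f x) (mfderiv_injective f x)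
    (tangentONB x) (tangentONB (f x)) (θ (f x))
  have h2 : √((sigma k f x ^ 2 * ∑ i : Fin k → Fin n, (θ (f x) fun a => tangentONB (f x) (i a)) ^ 2)
      / (k.factorial : ℝ)) = sigma k f x * formNorm (θ (f x)) := by
    rw [mul_div_assoc, Real.sqrt_mul (sq_nonneg _), Real.sqrt_sq (sigma_nonneg f k x), formNorm]
  rw [← h2]
  exact Real.sqrt_le_sqrt (div_le_div_of_nonneg_right h (by positivity))

theorem jacobian_mul_formNorm_le {k : ℕ} (θ : DForm n N k) (x : M) :
    jacobian f x * formNorm (θ (f x)) ≤ sigma (n - k) f x * formNorm (pullback f θ x) := by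
  have h := principalInvariant_sq_mul_sum_sq_le (V := TangentSpace (𝓡 n) x)
    (W := TangentSpace (𝓡 n) (f x))
    (finrank_tangent x) (finrank_tangent (f x)) (mfderiv (𝓡 n) (𝓡 n) f x) (mfderiv_injective f x)
    (tangentONB x) (tangentONB (f x)) (θ (f x))
  have h2 : √((jacobian f x ^ 2 *
      ∑ i : Fin k → Fin n, (θ (f x) fun a => tangentONB (f x) (i a)) ^ 2)
      / (k.factorial : ℝ)) = jacobian f x * formNorm (θ (f x)) := by
    rw [mul_div_assoc, Real.sqrt_mul (sq_nonneg _), Real.sqrt_sq (jacobian_pos f x).le, formNorm]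
  have h3 : √((sigma (n - k) f x ^ 2 *
      ∑ i : Fin k → Fin n, (pullback f θ x fun a => tangentONB x (i a)) ^ 2)
      / (k.factorial : ℝ)) = sigma (n - k) f x * formNorm (pullback f θ x) := by
    rw [mul_div_assoc, Real.sqrt_mul (sq_nonneg _), Real.sqrt_sq (sigma_nonneg f _ x), formNorm]
  rw [← h2, ← h3]
  exact Real.sqrt_le_sqrt (div_le_div_of_nonneg_right h (by positivity))

variable [IsManifold (𝓡 n) ∞ M] [SecondCountableTopology M] [MeasurableSpace M] [BorelSpace M]
  [IsContMDiffRiemannianBundle (𝓡 n) ∞ (Model n) (fun x : M => TangentSpace (𝓡 n) x)]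
  [IsManifold (𝓡 n) ∞ N] [SecondCountableTopology N] [MeasurableSpace N] [BorelSpace N]
  [IsContMDiffRiemannianBundle (𝓡 n) ∞ (Model n) (fun x : N => TangentSpace (𝓡 n) x)]

theorem eLpNorm_riemVolume_eq (g : N → ℝ) {p : ℝ≥0∞} (hp : p ≠ 0) (hp' : p ≠ ⊤) :
    eLpNorm g p (riemVolume n N) =
      eLpNorm (fun x => jacobian f x ^ (1 / p.toReal) * g (f x)) p (riemVolume n M) := by
  have hp0 : 0 < p.toReal := ENNReal.toReal_pos hp hp'
  rw [eLpNorm_eq_lintegral_rpow_enorm_toReal hp hp', eLpNorm_eq_lintegral_rpow_enorm_toReal hp hp',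
    riemVolume_eq_map f, (measurableEmbedding_diffeomorph f).lintegral_map,
    lintegral_withDensity_eq_lintegral_mul_non_measurable _
      (continuous_jacobian f).measurable.ennreal_ofReal (by simp)]
  congr 1
  refine lintegral_congr fun x => ?_
  have hJ := jacobian_pos f x
  have hJp : 0 ≤ jacobian f x ^ (1 / p.toReal) := Real.rpow_nonneg hJ.le _
  rw [Pi.mul_apply, enorm_mul, ENNReal.mul_rpow_of_nonneg _ _ hp0.le,
    Real.enorm_of_nonneg hJp, ENNReal.ofReal_rpow_of_nonneg hJp hp0.le,
    ← Real.rpow_mul hJ.le, one_div_mul_cancel hp0.ne', Real.rpow_one]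

/-- As `J_f > 0`, the volume of `M` is absolutely continuous with respect to its multiple by `J_f`,
whose image under `f` is the volume of `N`. -/
theorem aemeasurable_formNorm_comp {k : ℕ} {θ : DForm n N k} (hθ : IsLocIntegrable θ) :
    AEMeasurable (fun x => formNorm (θ (f x))) (riemVolume n M) := by
  have hJ : Measurable fun x => ENNReal.ofReal (jacobian f x) :=
    (continuous_jacobian f).measurable.ennreal_ofReal
  have h1 := aemeasurable_formNorm hθ
  rw [riemVolume_eq_map f] at h1
  refine (h1.comp_aemeasurable f.continuous.aemeasurable).mono_ac
    (withDensity_absolutelyContinuous' hJ.aemeasurable (Filter.Eventually.of_forall fun x => ?_))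
  exact (ENNReal.ofReal_pos.2 (jacobian_pos f x)).ne'

/-- A diffeomorphism with bounded distortion in degree `k` acts boundedly on `k`-forms. -/
theorem exists_eLpFormNorm_pullback_le {k : ℕ} {p p' : ℝ≥0∞} (h1 : 1 ≤ p) (hp : p ≤ p')
    (hp' : p' < ⊤) (hf : BoundedDistortion k p'.toReal (p / (p' - p)) f) :
    ∃ C : ℝ≥0∞, C ≠ ⊤ ∧ ∀ θ : DForm n N k, IsLocIntegrable θ →
      eLpFormNorm p (pullback f θ) ≤ C * eLpFormNorm p' θ := by
  obtain ⟨-, -, hmem⟩ := hf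
  have hp0 : p' ≠ 0 := (zero_lt_one.trans_le (h1.trans hp)).ne'
  have hs : 0 < p'.toReal := ENNReal.toReal_pos hp0 hp'.ne
  have := holderTriple_pullback h1 hp hp'
  -- The constant is `‖σ_k^{p'}/J‖_t^{1/p'}`.
  refine ⟨_, ENNReal.rpow_ne_top_of_nonneg (one_div_pos.2 hs).le hmem.eLpNorm_ne_top,
    fun θ hθ => ?_⟩
  rw [eLpFormNorm, eLpFormNorm, eLpNorm_riemVolume_eq f _ hp0 hp'.ne]
  refine eLpNorm_le_of_le_rpow_mul (one_div_pos.2 hs) hmem.aestronglyMeasurable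
    (((continuous_jacobian f).measurable.aemeasurable.pow_const _).mul
      (aemeasurable_formNorm_comp f hθ)).aestronglyMeasurable fun x => ?_
  have hJ := jacobian_pos f x
  have hσ := sigma_nonneg f k x
  have hN := formNorm_nonneg (θ (f x))
  rw [Real.norm_of_nonneg (formNorm_nonneg _), Real.norm_of_nonneg (by positivity),
    Real.norm_of_nonneg (by positivity), Real.mul_rpow (by positivity) (by positivity),
    ← Real.rpow_mul hσ, mul_one_div_cancel hs.ne', Real.rpow_one, Real.inv_rpow hJ.le]
  have hJp : jacobian f x ^ (1 / p'.toReal) ≠ 0 := (Real.rpow_pos_of_pos hJ _).ne'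
  rw [mul_assoc, inv_mul_cancel_left₀ hJp]
  exact formNorm_pullback_le f θ x

/-- A diffeomorphism with bounded distortion in the complementary degree controls `j`-forms by
their pullbacks. -/
theorem exists_eLpFormNorm_le_pullback {j : ℕ} {q q' : ℝ≥0∞} (h1 : 1 < q') (hq : q' ≤ q)
    (hq' : q < ⊤) (hf : BoundedDistortion (n - j) (q'.toReal / (q'.toReal - 1))
      (q * (q' - 1) / (q - q')) f) :
    ∃ C : ℝ≥0∞, C ≠ ⊤ ∧ ∀ θ : DForm n N j, IsLocIntegrable θ →
      eLpFormNorm q' θ ≤ C * eLpFormNorm q (pullback f θ) := by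
  obtain ⟨-, -, hmem⟩ := hf
  have hq0 : q' ≠ 0 := (zero_lt_one.trans h1).ne'
  have hqt : q' ≠ ⊤ := (hq.trans_lt hq').ne
  have hs1 : 1 < q'.toReal := (ENNReal.toReal_lt_toReal ENNReal.one_ne_top hqt).2 h1
  have hs : 0 < q'.toReal := by linarith
  have hs' : 0 < q'.toReal - 1 := by linarith
  have ha : 0 < (q'.toReal - 1) / q'.toReal := by positivity
  have := holderTriple_pushforward h1 hq hq'
  -- With `s = q'/(q'-1)`, the constant is the `L^r` norm of `σ_{n-j}^s/J` to the power `1/s`.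
  refine ⟨_, ENNReal.rpow_ne_top_of_nonneg ha.le hmem.eLpNorm_ne_top, fun θ hθ => ?_⟩
  rw [eLpFormNorm, eLpFormNorm, eLpNorm_riemVolume_eq f _ hq0 hqt]
  refine eLpNorm_le_of_le_rpow_mul ha hmem.aestronglyMeasurable
    (aemeasurable_formNorm (hθ.pullback f)).aestronglyMeasurable fun x => ?_
  have hJ := jacobian_pos f x
  have hσ := sigma_nonneg f (n - j) x
  have hN := formNorm_nonneg (θ (f x))
  rw [Real.norm_of_nonneg (formNorm_nonneg _), Real.norm_of_nonneg (by positivity),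
    Real.norm_of_nonneg (by positivity), Real.mul_rpow (by positivity) (by positivity),
    ← Real.rpow_mul hσ, div_mul_div_cancel₀ hs'.ne', div_self hs.ne', Real.rpow_one,
    Real.inv_rpow hJ.le]
  -- A full factor `J` is split off for `jacobian_mul_formNorm_le`; the remaining `J^{-1/s}` belongs
  -- to the distortion.
  have hsplit : jacobian f x ^ (1 / q'.toReal) =
      (jacobian f x ^ ((q'.toReal - 1) / q'.toReal))⁻¹ * jacobian f x := by
    rw [← Real.rpow_neg hJ.le, ← Real.rpow_add_one hJ.ne']
    congr 1
    field_simp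
    ring
  rw [hsplit, mul_comm (sigma _ _ _), mul_assoc, mul_assoc]
  exact mul_le_mul_of_nonneg_left (jacobian_mul_formNorm_le f θ x) (by positivity)

end Norms

/-! ### Pullback of closed and exact forms -/

section Operators

variable {n : ℕ} {M N : Type*} [TopologicalSpace M] [ChartedSpace (Model n) M]
  [TopologicalSpace N] [ChartedSpace (Model n) N] (f : M ≃ₘ^∞⟮𝓡 n, 𝓡 n⟯ N)

theorem pullback_zero {k : ℕ} : pullback f (0 : DForm n N k) = 0 := rfl

variable [IsManifold (𝓡 n) ∞ M] [SecondCountableTopology M] [MeasurableSpace M] [BorelSpace M]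
  [RiemannianBundle (fun x : M => TangentSpace (𝓡 n) x)]
  [IsContMDiffRiemannianBundle (𝓡 n) ∞ (Model n) (fun x : M => TangentSpace (𝓡 n) x)]
  [IsManifold (𝓡 n) ∞ N] [SecondCountableTopology N] [MeasurableSpace N] [BorelSpace N]
  [RiemannianBundle (fun x : N => TangentSpace (𝓡 n) x)]
  [IsContMDiffRiemannianBundle (𝓡 n) ∞ (Model n) (fun x : N => TangentSpace (𝓡 n) x)]

/-- The pullback under a diffeomorphism with bounded distortion, as an operator between the
spaces of `p`-integrable forms. -/
theorem exists_pullbackCLM {k : ℕ} {p p' : ℝ≥0∞} [h1 : Fact (1 ≤ p)] [Fact (1 ≤ p')] (hp : p ≤ p')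
    (hp' : p' < ⊤) (hf : BoundedDistortion k p'.toReal (p / (p' - p)) f) :
    ∃ T : LpForm n N p' k →L[ℝ] LpForm n M p k, ∀ θ, (T θ).form = pullback f θ.form := by
  obtain ⟨C, hC, hle⟩ := exists_eLpFormNorm_pullback_le f h1.out hp hp' hf
  have hlt : ∀ θ : LpForm n N p' k, C * eLpFormNorm p' θ.form < ⊤ := fun θ =>
    ENNReal.mul_lt_top hC.lt_top θ.eLpFormNorm_lt_top
  let T : LpForm n N p' k →ₗ[ℝ] LpForm n M p k :=
    { toFun := fun θ => (⟨pullback f θ.form, θ.isLocIntegrable.pullback f,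
        (hle _ θ.isLocIntegrable).trans_lt (hlt θ)⟩ : lpSubmodule n M p k)
      map_add' := fun θ θ' => Subtype.ext rfl
      map_smul' := fun c θ => Subtype.ext rfl }
  refine ⟨T.mkContinuous C.toReal fun θ => ?_, fun θ => rfl⟩
  rw [LpForm.norm_def, LpForm.norm_def, ← ENNReal.toReal_mul]
  exact ENNReal.toReal_mono (hlt θ).ne (hle _ θ.isLocIntegrable)

variable {p p' q q' : ℝ≥0∞} [Fact (1 ≤ p)] [Fact (1 ≤ p')] [Fact (1 ≤ q)] [Fact (1 ≤ q')]
  {o : OrientedAtlas n M} {o' : OrientedAtlas n N}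

theorem mem_closedForms_of_form_eq {k : ℕ} {θ : LpForm n N p' k} {θ' : LpForm n M p k}
    (h : θ'.form = pullback f θ.form) (hθ : θ ∈ closedForms o' p' k) :
    θ' ∈ closedForms o p k := by
  have h2 := IsWeakDeriv.pullback (o := o) f (show IsWeakDeriv o' θ.form 0 from hθ)
  rw [← h, pullback_zero] at h2
  exact h2

theorem mem_exactForms_of_form_eq {j : ℕ} {S : LpForm n N q' j → LpForm n M q j}
    (hS : ∀ β, (S β).form = pullback f β.form) {θ : LpForm n N p' (j + 1)}
    {θ' : LpForm n M p (j + 1)} (h : θ'.form = pullback f θ.form)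
    (hθ : θ ∈ exactForms o' q' p' (j + 1)) : θ' ∈ exactForms o q p (j + 1) := by
  obtain ⟨β, hβ⟩ := hθ
  refine ⟨S β, ?_⟩
  rw [hS, h]
  exact IsWeakDeriv.pullback f hβ

/-- A primitive `β` of `f^*θ` gives the primitive `(f⁻¹)^*β` of `θ`. Its `L^{q'}` norm is finite by
the estimate from below, since its own pullback is `β`. -/
theorem mem_exactForms_of_pullback_mem {j : ℕ} (h1 : 1 < q') (hq : q' ≤ q) (hq' : q < ⊤)
    (hf : BoundedDistortion (n - j) (q'.toReal / (q'.toReal - 1)) (q * (q' - 1) / (q - q')) f)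
    {θ : LpForm n N p' (j + 1)} {θ' : LpForm n M p (j + 1)} (h : θ'.form = pullback f θ.form)
    (hθ' : θ' ∈ exactForms o q p (j + 1)) : θ ∈ exactForms o' q' p' (j + 1) := by
  obtain ⟨β, hβ⟩ := hθ'
  obtain ⟨C, hC, hle⟩ := exists_eLpFormNorm_le_pullback f h1 hq hq' hf
  have hloc : IsLocIntegrable (pullback f.symm β.form) := β.isLocIntegrable.pullback f.symm
  have hback : pullback f (pullback f.symm β.form) = β.form := pullback_symm_pullback f.symm β.form
  have hlt := hle _ hloc
  rw [hback] at hlt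
  refine ⟨(⟨pullback f.symm β.form, hloc, hlt.trans_lt
    (ENNReal.mul_lt_top hC.lt_top β.eLpFormNorm_lt_top)⟩ : lpSubmodule n N q' j), ?_⟩
  have h2 := IsWeakDeriv.pullback (o := o') f.symm hβ
  rw [h, pullback_symm_pullback] at h2
  exact h2

end Operators

end

end LqpCohomology

/-! ### The theorem -/

theorem theorem6p1
    (n : ℕ)
    -- the oriented Riemannian manifold `M`
    (M : Type*) [TopologicalSpace M] [T2Space M] [SecondCountableTopology M]
    [ChartedSpace (Model n) M] [IsManifold (𝓡 n) ∞ M] [MeasurableSpace M] [BorelSpace M]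
    [RiemannianBundle (fun x : M => TangentSpace (𝓡 n) x)]
    [IsContMDiffRiemannianBundle (𝓡 n) ∞ (Model n) (fun x : M => TangentSpace (𝓡 n) x)]
    (o : OrientedAtlas n M)
    -- the oriented Riemannian manifold `M'`, the target of `f`
    (M' : Type*) [TopologicalSpace M'] [T2Space M'] [SecondCountableTopology M']
    [ChartedSpace (Model n) M'] [IsManifold (𝓡 n) ∞ M'] [MeasurableSpace M'] [BorelSpace M']
    [RiemannianBundle (fun x : M' => TangentSpace (𝓡 n) x)]
    [IsContMDiffRiemannianBundle (𝓡 n) ∞ (Model n) (fun x : M' => TangentSpace (𝓡 n) x)]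
    (o' : OrientedAtlas n M')
    (f : M ≃ₘ^∞⟮𝓡 n, 𝓡 n⟯ M')
    (k : ℕ) (p p' : ℝ≥0∞) [Fact (1 ≤ p)] [Fact (1 ≤ p')] (hp : p ≤ p') (hp' : p' < ⊤)
    (hf : BoundedDistortion k p'.toReal (p / (p' - p)) f) :
    -- (A)
    ∃ T : LpForm n M' p' k →L[ℝ] LpForm n M p k,
      (∀ θ, (T θ).form = pullback f θ.form) ∧
      ∃ hT : ∀ θ ∈ closedForms o' p' k, T θ ∈ closedForms o p k,
      -- (B)
      (∀ (q q' : ℝ≥0∞) [Fact (1 ≤ q)] [Fact (1 ≤ q')], 1 ≤ k → 1 < q' → q' ≤ q → q < ⊤ →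
        BoundedDistortion (n + 1 - k) (q'.toReal / (q'.toReal - 1))
          (q * (q' - 1) / (q - q')) f →
        (∀ (θ : LpForm n M' p' k) (hθ : θ ∈ closedForms o' p' k),
          (Submodule.Quotient.mk ⟨T θ, hT θ hθ⟩ : Cohomology o q p k) = 0 →
          (Submodule.Quotient.mk ⟨θ, hθ⟩ : Cohomology o' q' p' k) = 0) ∧
        (Subsingleton (Cohomology o q p k) → Subsingleton (Cohomology o' q' p' k))) ∧
      -- (C)
      (∀ (q q' : ℝ≥0∞) [Fact (1 ≤ q)] [Fact (1 ≤ q')], 1 ≤ k → q ≤ q' → q' < ⊤ →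
        BoundedDistortion (k - 1) q'.toReal (q / (q' - q)) f →
        (∃ S : Omega o' q' p' (k - 1) →L[ℝ] Omega o q p (k - 1),
          ∀ z, (S z).1.1.form = pullback f z.1.1.form ∧
            (S z).1.2.form = pullback f z.1.2.form) ∧
        (∃ F : Cohomology o' q' p' k →ₗ[ℝ] Cohomology o q p k,
          ∀ (θ : LpForm n M' p' k) (hθ : θ ∈ closedForms o' p' k),
            F (Submodule.Quotient.mk ⟨θ, hθ⟩) = Submodule.Quotient.mk ⟨T θ, hT θ hθ⟩) ∧
        (∃ F : ReducedCohomology o' q' p' k →L[ℝ] ReducedCohomology o q p k,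
          ∀ (θ : LpForm n M' p' k) (hθ : θ ∈ closedForms o' p' k),
            F (Submodule.Quotient.mk ⟨θ, hθ⟩) = Submodule.Quotient.mk ⟨T θ, hT θ hθ⟩)) := by
  obtain ⟨T, hT⟩ := exists_pullbackCLM f hp hp' hf
  have hcl : ∀ θ ∈ closedForms o' p' k, T θ ∈ closedForms o p k :=
    fun θ hθ => mem_closedForms_of_form_eq f (hT θ) hθ
  refine ⟨T, hT, hcl, ?_, ?_⟩
  · intro q q' _ _ hk hq1 hqq hq hBD
    obtain ⟨j, rfl⟩ := Nat.exists_eq_add_of_le' hk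
    rw [Nat.add_sub_add_right] at hBD
    have hmem : ∀ θ : LpForm n M' p' (j + 1), T θ ∈ exactForms o q p (j + 1) →
        θ ∈ exactForms o' q' p' (j + 1) :=
      fun θ => mem_exactForms_of_pullback_mem f hq1 hqq hq hBD (hT θ)
    have hzero : ∀ (θ : LpForm n M' p' (j + 1)) (hθ : θ ∈ closedForms o' p' (j + 1)),
        (Submodule.Quotient.mk ⟨T θ, hcl θ hθ⟩ : Cohomology o q p (j + 1)) = 0 →
        (Submodule.Quotient.mk ⟨θ, hθ⟩ : Cohomology o' q' p' (j + 1)) = 0 := by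
      intro θ hθ h
      rw [Submodule.Quotient.mk_eq_zero] at h ⊢
      exact hmem θ h
    refine ⟨hzero, fun hsub => ⟨fun a b => ?_⟩⟩
    have h0 : ∀ c : Cohomology o' q' p' (j + 1), c = 0 := by
      intro c
      obtain ⟨⟨θ, hθ⟩, rfl⟩ := Submodule.Quotient.mk_surjective _ c
      exact hzero θ hθ (Subsingleton.elim _ _)
    rw [h0 a, h0 b]
  · intro q q' _ _ hk hqq hq hBD
    obtain ⟨j, rfl⟩ := Nat.exists_eq_add_of_le' hk
    obtain ⟨S, hS⟩ := exists_pullbackCLM (k := j) f hqq hq hBD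
    have hex : ∀ θ ∈ exactForms o' q' p' (j + 1), T θ ∈ exactForms o q p (j + 1) :=
      fun θ => mem_exactForms_of_form_eq f hS (hT θ)
    -- Both maps in cohomology are induced by this restriction of `T`; the operator on `Omega` is
    -- the restriction of `S × T` to the pairs `(β, dβ)`.
    let R : closedForms o' p' (j + 1) →L[ℝ] closedForms o p (j + 1) :=
      (T.comp (closedForms o' p' (j + 1)).subtypeL).codRestrict _ fun θ => hcl θ.1 θ.2
    refine ⟨⟨((S.prodMap T).comp (Omega o' q' p' j).subtypeL).codRestrict (Omega o q p j)
      fun z => ?_, fun z => ⟨hS z.1.1, hT z.1.2⟩⟩, ⟨Submodule.mapQ _ _ R.toLinearMap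
        fun θ hθ => hex θ.1 hθ, fun θ hθ => rfl⟩, ⟨⟨Submodule.mapQ _ _ R.toLinearMap
        fun θ hθ => ?_, ?_⟩, fun θ hθ => rfl⟩⟩
    · change IsWeakDeriv o (S z.1.1).form (T z.1.2).form
      rw [hS, hT]
      exact IsWeakDeriv.pullback f z.2
    -- A continuous map that sends exact forms to exact forms sends the closure into the closure.
    · change T θ.1 ∈ closure (exactForms o q p (j + 1) : Set (LpForm n M p (j + 1)))
      have hθ' : θ.1 ∈ closure (exactForms o' q' p' (j + 1) : Set (LpForm n M' p' (j + 1))) := hθ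
      exact map_mem_closure T.continuous hθ' hex
    · exact continuous_quot_lift _ (continuous_quot_mk.comp R.continuous)
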